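/- **Notation.** Let $N\ge 1$ and $\mathcal F f(\xi)=\int_{\mathbb R^N}f(x)e^{-2\pi i x\cdot\xi}\,dx$. Fix an even real-valued $\phi_0\in\mathcal S(\mathbb R^N)$ with $\operatorname{supp}\phi_0=\{\tfrac34\le|\xi|\le\tfrac83\}$ and $\phi_0>0$ on $\{\tfrac34<|\xi|<\tfrac83\}$. Put $\phi_q(\xi)=\phi_0(2^{-q}\xi)$ for $q\in\mathbb Z$ and define $\Phi_q\in\mathcal S(\mathbb R^N)$ by $\mathcal F\Phi_q=\phi_q/\sum_{k\in\mathbb Z}\phi_k$ (with value $0$ at $\xi=0$). Let $\dot\Delta_q u=\Phi_q*u$ and $[f,\dot\Delta_q]g=f\,\dot\Delta_q g-\dot\Delta_q(fg)$. For $T>0$ let $\|\cdot\|_{L^\theta_T(L^p)}$ be the norm of $L^\theta(0,T;L^p(\mathbb R^N))$, and set $$\|u\|_{\dot B^{s}_{p,r}}=\Big\|\big(2^{qs}\|\dot\Delta_q u\|_{L^p}\big)_{q\in\mathbb Z}\Big\|_{\ell^r(\mathbb Z)},\qquad \|u\|_{\widetilde L^\theta_T(\dot B^{s}_{p,r})}=\Big\|\big(2^{qs}\|\dot\Delta_q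 u\|_{L^\theta_T(L^p)}\big)_{q\in\mathbb Z}\Big\|_{\ell^r(\mathbb Z)}.$$ Functions are complex-valued and $\nabla$ is the weak gradient in $x$. **Proposition 5.1.** Let $s>-1$, $1\le p\le\infty$ and $1\le r\le\infty$. There is a constant $C>0$, depending only on $N,\phi_0,s,p,r$, such that the following hold for all $p_1,p_2\in[1,\infty]$ with $\frac1p=\frac1{p_1}+\frac1{p_2}$. 1. Let $f$ be locally integrable on $\mathbb R^N$ with $\nabla f\in L^\infty$ and $\|f\|_{\dot B^{s+1}_{p_2,r}}<\infty$, and let $g\in L^{p_1}$ with $\|g\|_{\dot B^s_{p,r}}<\infty$. Then there is a sequence $(c_q)_{q\in\mathbb Z}$ of nonnegative numbers with $\|(c_q)\|_{\ell^r}\le1$ such that, for every $q\in\mathbb Z$, $$\|[f,\dot\Delta_q]g\|_{L^p}\le C\,c_q\,2^{-q(s+1)}\Big(\|\nabla f\|_{L^\infty}\|g\|_{\dot B^{s}_{p,r}}+\|g\|_{L^{p_1}}\|f\|_{\dot B^{s+1}_{p_2,r}}\Big).$$ 2. Let $\theta,\theta_1,\theta_2,\theta_3,\theta_4\in[1,\infty]$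 with $\frac1\theta=\frac1{\theta_1}+\frac1{\theta_2}=\frac1{\theta_3}+\frac1{\theta_4}$ and let $0<T<\infty$. Let $f,g$ be measurable on $(0,T)\times\mathbb R^N$, with $f(t)$ locally integrable and weakly differentiable for almost every $t$, with $\nabla f$ measurable on $(0,T)\times\mathbb R^N$, and with the four norms on the right-hand side below finite. Then there is a sequence $(c_q)_{q\in\mathbb Z}$ of nonnegative numbers with $\|(c_q)\|_{\ell^r}\le1$ such that, for every $q\in\mathbb Z$, $$\|[f,\dot\Delta_q]g\|_{L^\theta_T(L^p)}\le C\,c_q\,2^{-q(s+1)}\Big(\|\nabla f\|_{L^{\theta_1}_T(L^\infty)}\|g\|_{\widetilde L^{\theta_2}_T(\dot B^{s}_{p,r})}+\|g\|_{L^{\theta_3}_T(L^{p_1})}\|f\|_{\widetilde L^{\theta_4}_T(\dot B^{s+1}_{p_2,r})}\Big).$$ -/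

import Mathlib

open MeasureTheory Set
open scoped ENNReal NNReal SchwartzMap FourierTransform Convolution

noncomputable section

/-- The generating function of the dyadic partition: a real, even Schwartz function on `ℝ^N` whose
support is the closed annulus `3/4 ≤ |ξ| ≤ 8/3` and which is positive in the interior of that
annulus (on its boundary it vanishes by continuity). -/
structure IsDyadicGenerator {N : ℕ} (φ : 𝓢(EuclideanSpace ℝ (Fin N), ℝ)) : Prop where
  even : ∀ ξ, φ (-ξ) = φ ξ
  tsupport_eq : tsupport φ = {ξ | 3 / 4 ≤ ‖ξ‖ ∧ ‖ξ‖ ≤ 8 / 3}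
  pos : ∀ ξ, 3 / 4 < ‖ξ‖ → ‖ξ‖ < 8 / 3 → 0 < φ ξ

/-- The symbol `φ_q / ∑_k φ_k`, where `φ_k(ξ) = φ(2^{-k} ξ)`. The sum has at most two nonzero terms
at every `ξ`; at `ξ = 0` numerator and denominator vanish and the value is `0`. -/
def dyadicSymbol {N : ℕ} (φ : 𝓢(EuclideanSpace ℝ (Fin N), ℝ)) (q : ℤ)
    (ξ : EuclideanSpace ℝ (Fin N)) : ℂ :=
  ((φ ((2 : ℝ) ^ (-q) • ξ) / ∑' k : ℤ, φ ((2 : ℝ) ^ (-k) • ξ) : ℝ) : ℂ)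

/-- The kernel `Φ_q`, the inverse Fourier transform of the symbol (the Fourier transform is
`∫ f(x) exp(-2πi x·ξ) dx`). -/
def dyadicKernel {N : ℕ} (φ : 𝓢(EuclideanSpace ℝ (Fin N), ℝ)) (q : ℤ) :
    EuclideanSpace ℝ (Fin N) → ℂ :=
  𝓕⁻ (dyadicSymbol φ q)

/-- The homogeneous dyadic block `Δ̇_q u = Φ_q * u`. The kernel is a Schwartz function, so the
convolution integral converges at every point for every function `u` that is a product of a function
of polynomial growth and a function in some Lebesgue space. -/
def dyadicBlock {N : ℕ} (φ : 𝓢(EuclideanSpace ℝ (Fin N), ℝ)) (q : ℤ)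
    (u : EuclideanSpace ℝ (Fin N) → ℂ) : EuclideanSpace ℝ (Fin N) → ℂ :=
  dyadicKernel φ q ⋆[ContinuousLinearMap.mul ℂ ℂ, volume] u

/-- The commutator `[f, Δ̇_q] g = f Δ̇_q g - Δ̇_q (f g)`. -/
def dyadicCommutator {N : ℕ} (φ : 𝓢(EuclideanSpace ℝ (Fin N), ℝ)) (q : ℤ)
    (f g : EuclideanSpace ℝ (Fin N) → ℂ) : EuclideanSpace ℝ (Fin N) → ℂ :=
  fun x => f x * dyadicBlock φ q g x - dyadicBlock φ q (fun y => f y * g y) x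

/-- The norm of `ℓ^r(ℤ)`: the `L^r` norm for the counting measure. -/
def ellNorm (r : ℝ≥0∞) (a : ℤ → ℝ≥0∞) : ℝ≥0∞ :=
  eLpNorm a r Measure.count

/-- The norm of the homogeneous Besov space `Ḃ^s_{p,r}`, with values in `[0, ∞]`. -/
def homBesovNorm {N : ℕ} (φ : 𝓢(EuclideanSpace ℝ (Fin N), ℝ)) (s : ℝ) (p r : ℝ≥0∞)
    (u : EuclideanSpace ℝ (Fin N) → ℂ) : ℝ≥0∞ :=
  ellNorm r fun q => (2 : ℝ≥0∞) ^ ((q : ℝ) * s) * eLpNorm (dyadicBlock φ q u) p volume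

/-- The norm of `L^θ(0, T; L^p(ℝ^N; V))`, with values in `[0, ∞]`. -/
def mixedNorm {N : ℕ} {V : Type*} [NormedAddCommGroup V] (T : ℝ) (θ p : ℝ≥0∞)
    (u : ℝ → EuclideanSpace ℝ (Fin N) → V) : ℝ≥0∞ :=
  eLpNorm (fun t => eLpNorm (u t) p volume) θ (volume.restrict (Ioo 0 T))

/-- The norm of the homogeneous Chemin-Lerner space `L̃^θ_T(Ḃ^s_{p,r})`, with values in
`[0, ∞]`. -/
def cheminLernerNorm {N : ℕ} (φ : 𝓢(EuclideanSpace ℝ (Fin N), ℝ)) (T : ℝ) (θ : ℝ≥0∞) (s : ℝ)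
    (p r : ℝ≥0∞) (u : ℝ → EuclideanSpace ℝ (Fin N) → ℂ) : ℝ≥0∞ :=
  ellNorm r fun q =>
    (2 : ℝ≥0∞) ^ ((q : ℝ) * s) * mixedNorm T θ p (fun t => dyadicBlock φ q (u t))

/-- `F` is the weak (distributional) gradient of `f` on `ℝ^N`. -/
structure HasWeakGradient {N : ℕ} (f : EuclideanSpace ℝ (Fin N) → ℂ)
    (F : EuclideanSpace ℝ (Fin N) → EuclideanSpace ℂ (Fin N)) : Prop where
  locallyIntegrable : LocallyIntegrable f volume
  locallyIntegrable_grad : LocallyIntegrable F volume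
  integral_eq : ∀ (ψ : EuclideanSpace ℝ (Fin N) → ℝ), ContDiff ℝ (⊤ : ℕ∞) ψ → HasCompactSupport ψ →
    ∀ i : Fin N, ∫ x, (fderiv ℝ ψ x (EuclideanSpace.single i 1) : ℝ) • f x
      = -∫ x, ψ x • F x i

/-- Joint measurability (up to null sets) of a function on `(0, T) × ℝ^N`. -/
def SpaceTimeMeasurable {N : ℕ} {V : Type*} [NormedAddCommGroup V] (T : ℝ)
    (u : ℝ → EuclideanSpace ℝ (Fin N) → V) : Prop :=
  AEStronglyMeasurable (Function.uncurry u)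
    ((volume.restrict (Ioo 0 T)).prod (volume : Measure (EuclideanSpace ℝ (Fin N))))

end

/-! A function with bounded weak gradient agrees almost everywhere with a Lipschitz function whose
constant `L` is a dimensional multiple of ‖∇f‖_∞. Commuting a Lipschitz `f` with convolution by κ
leaves ∫ κ(y) (f(x) - f(x-y)) u(x-y) dy, which costs `L` times the first absolute moment of κ. For
Φ_q this moment is a constant times 2^{-q}: one derivative is gained
(`eLpNorm_commutator_schwartzConv_le`).

To involve only the frequencies of g near or above 2^q, let S = ∑_{k<q-2} Δ_k be the low-pass filter
and split f = Sf + (f - Sf); see `dyadicCommutator_eq_add_sub`. The resulting pieces are controlled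
as follows. (a) [Sf, Δ_q]g only sees the blocks Δ_{q+k}g with |k| ≤ 2, because multiplication by Sf
moves frequencies too little; the moment bound gives L 2^{-q} ‖Δ_{q+k}g‖_p. (b) (f - Sf) Δ_q g is
bounded through ‖f - Sf‖_∞ ≲ L 2^{-q}. (c) Δ_q((f - Sf)g) = ∑_{j≥q-2} Δ_q(Δ_j f · g). For j ≤ q+2
Hölder gives ‖g‖_{p₁} ‖Δ_j f‖_{p₂}, the source of the second term of the estimate. For j ≥ q+3 only
the blocks Δ_{j+k}g with |k| ≤ 2 can interact with Δ_j f to reach frequency 2^q, and ‖Δ_j f‖_∞ ≲ L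
2^{-j}.

After multiplication by 2^{q(s+1)} the tail over j = q+n becomes a sum of shifts of 2^{js}‖Δ_j g‖_p
with weights 2^{-n(s+1)}. These weights are summable because s > -1, so Minkowski in ℓ^r concludes
(`exists_ellNorm_le_of_le_tail`).

Since f may grow linearly, frequency localization is proved as an identity between kernels
(`integral_fourierInv_mul_mul`), without Fourier transforms of distributions. The low frequencies of
f are never decomposed, so no convergence question arises there.

In Chemin-Lerner spaces the time norm sits inside the frequency sum. The bound at fixed q is
therefore integrated in time, by Minkowski and Hölder, before summing over q. The static estimate is
the case of time-independent functions. -/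

noncomputable section

/-! ### Minkowski, Hölder and Young inequalities for functions with values in [0, ∞]. -/

/-- For finite p, monotone convergence reduces the series to its partial sums, where the triangle
inequality applies. -/
theorem eLpNorm_tsum_le_tsum_eLpNorm {α : Type*} [MeasurableSpace α] {μ : Measure α} {p : ℝ≥0∞}
    (hp : 1 ≤ p) {F : ℕ → α → ℝ≥0∞} (hF : ∀ n, AEMeasurable (F n) μ) :
    eLpNorm (fun x => ∑' n, F n x) p μ ≤ ∑' n, eLpNorm (F n) p μ := by
  by_cases hpt : p = ∞
  · subst hpt
    simp only [eLpNorm_exponent_top]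
    refine essSup_le_of_ae_le _ ?_
    have h : ∀ᵐ x ∂μ, ∀ n, F n x ≤ eLpNormEssSup (F n) μ :=
      ae_all_iff.2 fun n => by simpa using ae_le_eLpNormEssSup (f := F n) (μ := μ)
    filter_upwards [h] with x hx
    exact ENNReal.tsum_le_tsum hx
  have hp0 : p ≠ 0 := (zero_lt_one.trans_le hp).ne'
  have hpr : 0 < p.toReal := ENNReal.toReal_pos hp0 hpt
  have hsum : ∀ n : ℕ, AEMeasurable (fun x => ∑ i ∈ Finset.range n, F i x) μ := fun n =>
    Finset.aemeasurable_fun_sum _ fun i _ => hF i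
  have hlim : ∫⁻ x, (∑' n, F n x) ^ p.toReal ∂μ
      = ⨆ n : ℕ, ∫⁻ x, (∑ i ∈ Finset.range n, F i x) ^ p.toReal ∂μ := by
    rw [← lintegral_iSup' (fun n => (hsum n).pow_const _)]
    · refine lintegral_congr fun x => ?_
      rw [ENNReal.tsum_eq_iSup_nat]
      exact (ENNReal.orderIsoRpow p.toReal hpr).map_iSup _
    · refine Filter.Eventually.of_forall fun x m n hmn => ?_
      exact ENNReal.rpow_le_rpow (Finset.sum_le_sum_of_subset (Finset.range_mono hmn)) hpr.le
  rw [eLpNorm_eq_lintegral_rpow_enorm_toReal hp0 hpt]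
  simp only [enorm_eq_self]
  rw [hlim, one_div, ENNReal.rpow_inv_le_iff hpr]
  refine iSup_le fun n => ?_
  rw [← ENNReal.rpow_inv_le_iff hpr, ← one_div]
  calc (∫⁻ x, (∑ i ∈ Finset.range n, F i x) ^ p.toReal ∂μ) ^ (1 / p.toReal)
      = eLpNorm (∑ i ∈ Finset.range n, F i) p μ := by
        rw [eLpNorm_eq_lintegral_rpow_enorm_toReal hp0 hpt]
        simp
    _ ≤ ∑ i ∈ Finset.range n, eLpNorm (F i) p μ :=
        eLpNorm_sum_le (fun i _ => (hF i).aestronglyMeasurable) hp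
    _ ≤ ∑' n, eLpNorm (F n) p μ := ENNReal.sum_le_tsum _

theorem eLpNorm_ennreal_add_le {α : Type*} [MeasurableSpace α] {μ : Measure α} {p : ℝ≥0∞}
    (hp : 1 ≤ p) {f g : α → ℝ≥0∞} (hf : AEMeasurable f μ) (hg : AEMeasurable g μ) :
    eLpNorm (fun x => f x + g x) p μ ≤ eLpNorm f p μ + eLpNorm g p μ :=
  eLpNorm_add_le hf.aestronglyMeasurable hg.aestronglyMeasurable hp

theorem eLpNorm_ennreal_sum_le {α ι : Type*} [MeasurableSpace α] {μ : Measure α} {p : ℝ≥0∞}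
    (hp : 1 ≤ p) {s : Finset ι} {F : ι → α → ℝ≥0∞} (hF : ∀ i ∈ s, AEMeasurable (F i) μ) :
    eLpNorm (fun x => ∑ i ∈ s, F i x) p μ ≤ ∑ i ∈ s, eLpNorm (F i) p μ := by
  have := eLpNorm_sum_le (μ := μ) (p := p) (f := F) (s := s)
    (fun i hi => (hF i hi).aestronglyMeasurable) hp
  rwa [show (∑ i ∈ s, F i) = fun x => ∑ i ∈ s, F i x from by ext; simp] at this

theorem eLpNorm_ennreal_const_mul_le {α : Type*} [MeasurableSpace α] {μ : Measure α} {p c : ℝ≥0∞}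
    {f : α → ℝ≥0∞} (hf : AEMeasurable f μ) :
    eLpNorm (fun x => c * f x) p μ ≤ c * eLpNorm f p μ :=
  eLpNorm_le_mul_eLpNorm_of_ae_le_mul'' p hf.aestronglyMeasurable
    (Filter.Eventually.of_forall fun x => by simp)

theorem eLpNorm_ennreal_mono {α : Type*} [MeasurableSpace α] {μ : Measure α} {p : ℝ≥0∞}
    {f g : α → ℝ≥0∞} (h : ∀ᵐ x ∂μ, f x ≤ g x) : eLpNorm f p μ ≤ eLpNorm g p μ :=
  eLpNorm_mono_enorm_ae (by simpa using h)

/-- Hölder's inequality for functions with values in `[0, ∞]` and finite norms. -/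
theorem eLpNorm_ennreal_mul_le {α : Type*} [MeasurableSpace α] {μ : Measure α} {p p₁ p₂ : ℝ≥0∞}
    (hp : p⁻¹ = p₁⁻¹ + p₂⁻¹) {f g : α → ℝ≥0∞} (hf : AEMeasurable f μ) (hg : AEMeasurable g μ)
    (hf' : ∀ᵐ x ∂μ, f x < ∞) (hg' : ∀ᵐ x ∂μ, g x < ∞) :
    eLpNorm (fun x => f x * g x) p μ ≤ eLpNorm f p₁ μ * eLpNorm g p₂ μ := by
  have : ENNReal.HolderTriple p₁ p₂ p := ⟨hp.symm⟩
  have key := eLpNorm_le_eLpNorm_mul_eLpNorm_of_nnnorm (p := p₁) (q := p₂) (r := p)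
    hf.ennreal_toReal.aestronglyMeasurable hg.ennreal_toReal.aestronglyMeasurable
    (fun a b : ℝ => a * b) 1 (Filter.Eventually.of_forall fun x => by simp)
  have h1 : ∀ {h : α → ℝ≥0∞} {q : ℝ≥0∞}, (∀ᵐ x ∂μ, h x < ∞) →
      eLpNorm (fun x => (h x).toReal) q μ = eLpNorm h q μ := fun {h q} hh =>
    eLpNorm_congr_enorm_ae (hh.mono fun x hx => by
      rw [Real.enorm_eq_ofReal ENNReal.toReal_nonneg, ENNReal.ofReal_toReal hx.ne, enorm_eq_self])
  rw [h1 hf', h1 hg', ENNReal.coe_one, one_mul] at key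
  refine le_trans (le_of_eq ?_) key
  rw [← h1 (h := fun x => f x * g x)]
  · simp
  · filter_upwards [hf', hg'] with x h1 h2 using ENNReal.mul_lt_top h1 h2

theorem measurable_eLpNorm_prod_right {α β V : Type*} [MeasurableSpace α] [MeasurableSpace β]
    [NormedAddCommGroup V] {ν : Measure β} [SFinite ν] {u : α → β → V}
    (hu : StronglyMeasurable (Function.uncurry u)) (p : ℝ≥0∞) :
    Measurable fun t => eLpNorm (u t) p ν := by
  have hm : Measurable (Function.uncurry fun t x => ‖u t x‖ₑ) := hu.enorm
  by_cases hp0 : p = 0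
  · simp [hp0]
  by_cases hpt : p = ∞
  · subst hpt
    simp only [eLpNorm_exponent_top]
    refine measurable_of_Iic fun a => ?_
    -- An essential supremum is at most `a` exactly when the superlevel set above `a` is null, and
    -- the measure of sections of a measurable set is measurable.
    have : (fun t => eLpNormEssSup (u t) ν) ⁻¹' Iic a
        = (fun t => ν {x | a < ‖u t x‖ₑ}) ⁻¹' {0} := by
      ext t
      simp only [mem_preimage, mem_Iic, mem_singleton_iff]
      rw [← not_iff_not]
      constructor
      · intro h h0
        exact h (essSup_le_of_ae_le _ (by
          change ∀ᵐ x ∂ν, ‖u t x‖ₑ ≤ a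
          rw [ae_iff]
          simpa using h0))
      · intro h h0
        refine h (measure_mono_null (fun x hx => ?_)
          (ae_iff.1 (ae_le_eLpNormEssSup (f := u t) (μ := ν))))
        exact not_le.2 (lt_of_le_of_lt h0 hx)
    rw [this]
    exact (measurable_measure_prodMk_left (hm measurableSet_Ioi)) (measurableSet_singleton 0)
  · simp only [eLpNorm_eq_lintegral_rpow_enorm_toReal hp0 hpt]
    exact ((hm.pow_const p.toReal).lintegral_prod_right').pow_const _

/-- An average of translates: Jensen in the finite measure `ν`, then Tonelli and translation
invariance of `μ`. -/
theorem eLpNorm_lintegral_sub_le_of_measurable {G : Type*} [MeasurableSpace G] [AddCommGroup G]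
    [MeasurableAdd₂ G] [MeasurableNeg G] {μ ν : Measure G} [SFinite μ] [μ.IsAddLeftInvariant]
    [μ.IsAddRightInvariant] [IsFiniteMeasure ν] {p : ℝ≥0∞} (hp : 1 ≤ p) {u : G → ℝ≥0∞}
    (hu : Measurable u) :
    eLpNorm (fun x => ∫⁻ y, u (x - y) ∂ν) p μ ≤ ν univ * eLpNorm u p μ := by
  have hshift : ∀ x, Measurable fun y => u (x - y) := fun x => by fun_prop
  by_cases hpt : p = ∞
  · subst hpt
    have hae : ∀ᵐ x ∂μ, u x ≤ eLpNorm u ∞ μ := by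
      simpa using ae_le_eLpNormEssSup (f := u) (μ := μ)
    have h1 : ∀ᵐ x ∂μ, ∀ᵐ y ∂ν, u (x - y) ≤ eLpNorm u ∞ μ := by
      have hset : MeasurableSet {z : G × G | u (z.1 - z.2) ≤ eLpNorm u ∞ μ} :=
        measurableSet_le (by fun_prop) measurable_const
      refine Measure.ae_ae_comm (p := fun y x => u (x - y) ≤ eLpNorm u ∞ μ) ?_ |>.1 ?_
      · exact measurable_swap hset
      · refine Filter.Eventually.of_forall fun y => ?_
        have := (measurePreserving_sub_right μ y).quasiMeasurePreserving.ae hae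
        simpa using this
    rw [eLpNorm_exponent_top (f := fun x => ∫⁻ y, u (x - y) ∂ν)]
    refine essSup_le_of_ae_le _ ?_
    filter_upwards [h1] with x hx
    calc ‖∫⁻ y, u (x - y) ∂ν‖ₑ ≤ ∫⁻ _, eLpNorm u ∞ μ ∂ν := by
          simpa using lintegral_mono_ae hx
      _ = ν univ * eLpNorm u ∞ μ := by rw [lintegral_const, mul_comm]
  have hp0 : p ≠ 0 := (zero_lt_one.trans_le hp).ne'
  have hpr : 0 < p.toReal := ENNReal.toReal_pos hp0 hpt
  have hp1 : 1 ≤ p.toReal := by simpa using ENNReal.toReal_mono hpt hp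
  have hpt' : ∀ x, (∫⁻ y, u (x - y) ∂ν) ^ p.toReal
      ≤ (∫⁻ y, u (x - y) ^ p.toReal ∂ν) * ν univ ^ (p.toReal - 1) := fun x => by
    have h := eLpNorm_le_eLpNorm_mul_rpow_measure_univ (μ := ν) hp
      (hshift x).aestronglyMeasurable
    rw [eLpNorm_one_eq_lintegral_enorm, eLpNorm_eq_lintegral_rpow_enorm_toReal hp0 hpt] at h
    simp only [enorm_eq_self, ENNReal.toReal_one] at h
    refine (ENNReal.rpow_le_rpow h hpr.le).trans (le_of_eq ?_)
    rw [ENNReal.mul_rpow_of_nonneg _ _ hpr.le, ← ENNReal.rpow_mul, ← ENNReal.rpow_mul,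
      one_div_mul_cancel hpr.ne', ENNReal.rpow_one]
    congr 2
    field_simp
  rw [eLpNorm_eq_lintegral_rpow_enorm_toReal hp0 hpt,
    eLpNorm_eq_lintegral_rpow_enorm_toReal hp0 hpt]
  simp only [enorm_eq_self]
  rw [one_div, ENNReal.rpow_inv_le_iff hpr, ENNReal.mul_rpow_of_nonneg _ _ hpr.le,
    ← ENNReal.rpow_mul, inv_mul_cancel₀ hpr.ne', ENNReal.rpow_one]
  have hswap : ∫⁻ x, ∫⁻ y, u (x - y) ^ p.toReal ∂ν ∂μ = (∫⁻ x, u x ^ p.toReal ∂μ) * ν univ := by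
    rw [lintegral_lintegral_swap (by fun_prop)]
    simp_rw [lintegral_sub_right_eq_self (μ := μ) (fun x => u x ^ p.toReal)]
    rw [lintegral_const]
  calc ∫⁻ x, (∫⁻ y, u (x - y) ∂ν) ^ p.toReal ∂μ
      ≤ ∫⁻ x, (∫⁻ y, u (x - y) ^ p.toReal ∂ν) * ν univ ^ (p.toReal - 1) ∂μ := lintegral_mono hpt'
    _ = ((∫⁻ x, u x ^ p.toReal ∂μ) * ν univ) * ν univ ^ (p.toReal - 1) := by
        rw [lintegral_mul_const _ ?_, hswap]
        exact Measurable.lintegral_prod_right' (f := fun z : G × G => u (z.1 - z.2) ^ p.toReal)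
          (by fun_prop)
    _ = ν univ ^ p.toReal * ∫⁻ x, u x ^ p.toReal ∂μ := by
        rw [mul_assoc, mul_comm]
        congr 1
        nth_rewrite 1 [← ENNReal.rpow_one (ν univ)]
        rw [← ENNReal.rpow_add_of_nonneg _ _ zero_le_one (by linarith)]
        congr 1
        ring

/-- Young's inequality `‖k * u‖_{L^p} ≤ ‖k‖_{L^1} ‖u‖_{L^p}` for nonnegative functions. -/
theorem eLpNorm_lintegral_mul_sub_le {G : Type*} [MeasurableSpace G] [AddCommGroup G]
    [MeasurableAdd₂ G] [MeasurableNeg G] {μ : Measure G} [SFinite μ] [μ.IsAddLeftInvariant]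
    [μ.IsAddRightInvariant] [μ.IsNegInvariant] {p : ℝ≥0∞} (hp : 1 ≤ p) {k u : G → ℝ≥0∞}
    (hk : Measurable k) (hk' : ∫⁻ y, k y ∂μ ≠ ∞) (hu : AEMeasurable u μ) :
    eLpNorm (fun x => ∫⁻ y, k y * u (x - y) ∂μ) p μ ≤ (∫⁻ y, k y ∂μ) * eLpNorm u p μ := by
  have hfin : IsFiniteMeasure (μ.withDensity k) := isFiniteMeasure_withDensity hk'
  have h := eLpNorm_lintegral_sub_le_of_measurable (μ := μ) (ν := μ.withDensity k) hp
    hu.measurable_mk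
  rw [withDensity_apply _ MeasurableSet.univ, Measure.restrict_univ,
    ← eLpNorm_congr_ae hu.ae_eq_mk] at h
  refine le_trans (le_of_eq ?_) h
  congr 1
  ext x
  have hm : Measurable fun y => hu.mk u (x - y) := hu.measurable_mk.comp (by fun_prop)
  rw [lintegral_withDensity_eq_lintegral_mul _ hk hm]
  refine lintegral_congr_ae ?_
  have := (quasiMeasurePreserving_sub_left μ x).ae hu.ae_eq_mk
  filter_upwards [this] with y hy
  simp [hy]

/-! ### The dyadic partition of unity and the low-pass symbol. -/

section Symbol

variable {N : ℕ} {φ : 𝓢(EuclideanSpace ℝ (Fin N), ℝ)}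

/-- The set where φ does not vanish is open and lies in the closed annulus, hence in its interior.
Nonnegativity of φ then follows from its positivity there. -/
theorem IsDyadicGenerator.norm_mem_of_ne_zero (hφ : IsDyadicGenerator φ)
    {ξ : EuclideanSpace ℝ (Fin N)} (h : φ ξ ≠ 0) : 3 / 4 < ‖ξ‖ ∧ ‖ξ‖ < 8 / 3 := by
  have hopen : IsOpen {ξ | φ ξ ≠ 0} := isOpen_ne_fun φ.continuous continuous_const
  have hsub : ∀ ξ, φ ξ ≠ 0 → 3 / 4 ≤ ‖ξ‖ ∧ ‖ξ‖ ≤ 8 / 3 := fun ξ hξ => by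
    have : ξ ∈ tsupport φ := subset_tsupport _ hξ
    rwa [hφ.tsupport_eq] at this
  have h1 : {ξ | φ ξ ≠ 0} ⊆ (Metric.closedBall 0 (3 / 4))ᶜ := by
    rw [← closure_ball (0 : EuclideanSpace ℝ (Fin N)) (by norm_num : (3 / 4 : ℝ) ≠ 0),
      ← interior_compl]
    exact interior_maximal (fun ξ hξ => by simpa using (hsub ξ hξ).1) hopen
  have h2 : {ξ | φ ξ ≠ 0} ⊆ Metric.ball 0 (8 / 3) := by
    rw [← interior_closedBall (0 : EuclideanSpace ℝ (Fin N)) (by norm_num : (8 / 3 : ℝ) ≠ 0)]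
    exact interior_maximal (fun ξ hξ => by simpa using (hsub ξ hξ).2) hopen
  exact ⟨by simpa using h1 h, by simpa using h2 h⟩

theorem IsDyadicGenerator.nonneg (hφ : IsDyadicGenerator φ) (ξ : EuclideanSpace ℝ (Fin N)) :
    0 ≤ φ ξ := by
  by_cases h : φ ξ = 0
  · exact h.ge
  · exact (hφ.pos ξ (hφ.norm_mem_of_ne_zero h).1 (hφ.norm_mem_of_ne_zero h).2).le

/-- The real symbol of the block `Δ̇_0`. -/
def blockSymbol (φ : 𝓢(EuclideanSpace ℝ (Fin N), ℝ)) (ξ : EuclideanSpace ℝ (Fin N)) : ℝ :=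
  φ ξ / ∑' k : ℤ, φ ((2 : ℝ) ^ (-k) • ξ)

theorem tsum_dyadic_smul (φ : 𝓢(EuclideanSpace ℝ (Fin N), ℝ)) (q : ℤ)
    (ξ : EuclideanSpace ℝ (Fin N)) :
    ∑' k : ℤ, φ ((2 : ℝ) ^ (-k) • (2 : ℝ) ^ (-q) • ξ) = ∑' k : ℤ, φ ((2 : ℝ) ^ (-k) • ξ) := by
  rw [← (Equiv.addRight q).tsum_eq (fun k : ℤ => φ ((2 : ℝ) ^ (-k) • ξ))]
  refine tsum_congr fun k => ?_
  rw [smul_smul, ← zpow_add₀ two_ne_zero, Equiv.coe_addRight, neg_add]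

theorem dyadicSymbol_eq (φ : 𝓢(EuclideanSpace ℝ (Fin N), ℝ)) (q : ℤ)
    (ξ : EuclideanSpace ℝ (Fin N)) :
    dyadicSymbol φ q ξ = (blockSymbol φ ((2 : ℝ) ^ (-q) • ξ) : ℂ) := by
  rw [dyadicSymbol, blockSymbol, tsum_dyadic_smul]

theorem two_zpow_mul_le {a b : ℝ} {k n : ℤ} (ha : 0 ≤ a) (hk : k ≤ n) (h : (2 : ℝ) ^ n * a ≤ b) :
    (2 : ℝ) ^ k * a ≤ b :=
  (mul_le_mul_of_nonneg_right (zpow_le_zpow_right₀ one_le_two hk) ha).trans h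

theorem le_two_zpow_mul {a b : ℝ} {k n : ℤ} (ha : 0 ≤ a) (hk : n ≤ k) (h : b ≤ (2 : ℝ) ^ n * a) :
    b ≤ (2 : ℝ) ^ k * a :=
  h.trans (mul_le_mul_of_nonneg_right (zpow_le_zpow_right₀ one_le_two hk) ha)

/-- Only the indices in a bounded range contribute to the dyadic sum over an annulus. -/
theorem IsDyadicGenerator.mem_Ioo_of_ne_zero (hφ : IsDyadicGenerator φ) {a b k : ℤ}
    {ξ : EuclideanSpace ℝ (Fin N)} (h : φ ((2 : ℝ) ^ (-k) • ξ) ≠ 0)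
    (ha : 8 / 3 ≤ (2 : ℝ) ^ (-a) * ‖ξ‖) (hb : (2 : ℝ) ^ (-b) * ‖ξ‖ ≤ 3 / 4) : a < k ∧ k < b := by
  have h1 := hφ.norm_mem_of_ne_zero h
  rw [norm_smul, norm_zpow, Real.norm_eq_abs, abs_two] at h1
  constructor
  · by_contra hk
    exact absurd (le_two_zpow_mul (norm_nonneg ξ) (by omega : -a ≤ -k) ha) (not_le.2 h1.2)
  · by_contra hk
    exact absurd (two_zpow_mul_le (norm_nonneg ξ) (by omega : -k ≤ -b) hb) (not_le.2 h1.1)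

theorem exists_two_zpow_mul_mem {x : ℝ} (hx : 0 < x) :
    ∃ k : ℤ, 1 ≤ (2 : ℝ) ^ (-k) * x ∧ (2 : ℝ) ^ (-k) * x < 2 := by
  obtain ⟨k, hk1, hk2⟩ := exists_mem_Ico_zpow hx one_lt_two
  refine ⟨k, ?_, ?_⟩
  · rw [zpow_neg, inv_mul_eq_div, le_div_iff₀ (by positivity), one_mul]; exact hk1
  · rw [zpow_neg, inv_mul_eq_div, div_lt_iff₀ (by positivity)]
    rwa [zpow_add_one₀ two_ne_zero, mul_comm] at hk2

theorem IsDyadicGenerator.summable (hφ : IsDyadicGenerator φ) {ξ : EuclideanSpace ℝ (Fin N)}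
    (hξ : ξ ≠ 0) : Summable fun k : ℤ => φ ((2 : ℝ) ^ (-k) • ξ) := by
  obtain ⟨k, hk1, hk2⟩ := exists_two_zpow_mul_mem (norm_pos_iff.2 hξ)
  refine summable_of_hasFiniteSupport ((Set.finite_Ioo (k - 2) (k + 2)).subset fun j hj => ?_)
  refine hφ.mem_Ioo_of_ne_zero hj ?_ ?_
  · rw [show -(k - 2) = -k + 2 by ring, zpow_add₀ two_ne_zero, mul_right_comm,
      show (2 : ℝ) ^ (2 : ℤ) = 4 by norm_num]
    linarith
  · rw [show -(k + 2) = -k + -2 by ring, zpow_add₀ two_ne_zero, mul_right_comm,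
      show (2 : ℝ) ^ (-2 : ℤ) = 1 / 4 by norm_num [zpow_neg]]
    linarith

theorem IsDyadicGenerator.tsum_pos (hφ : IsDyadicGenerator φ) {ξ : EuclideanSpace ℝ (Fin N)}
    (hξ : ξ ≠ 0) : 0 < ∑' k : ℤ, φ ((2 : ℝ) ^ (-k) • ξ) := by
  obtain ⟨k, hk1, hk2⟩ := exists_two_zpow_mul_mem (norm_pos_iff.2 hξ)
  have hn : ‖(2 : ℝ) ^ (-k) • ξ‖ = (2 : ℝ) ^ (-k) * ‖ξ‖ := by
    rw [norm_smul, norm_zpow, Real.norm_eq_abs, abs_two]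
  refine (hφ.summable hξ).tsum_pos (fun j => hφ.nonneg _) k (hφ.pos _ ?_ ?_) <;> rw [hn] <;> linarith

theorem blockSymbol_ne_zero (hφ : IsDyadicGenerator φ) {ξ : EuclideanSpace ℝ (Fin N)}
    (h : blockSymbol φ ξ ≠ 0) : 3 / 4 < ‖ξ‖ ∧ ‖ξ‖ < 8 / 3 :=
  hφ.norm_mem_of_ne_zero fun h0 => h (by rw [blockSymbol, h0, zero_div])

theorem blockSymbol_smul_ne_zero (hφ : IsDyadicGenerator φ) {k : ℤ}
    {ξ : EuclideanSpace ℝ (Fin N)}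
    (h : blockSymbol φ ((2 : ℝ) ^ (-k) • ξ) ≠ 0) :
    3 / 4 < (2 : ℝ) ^ (-k) * ‖ξ‖ ∧ (2 : ℝ) ^ (-k) * ‖ξ‖ < 8 / 3 := by
  have := blockSymbol_ne_zero hφ h
  rwa [norm_smul, norm_zpow, Real.norm_eq_abs, abs_two] at this

/-- The dyadic partition of unity. -/
theorem sum_blockSymbol (hφ : IsDyadicGenerator φ) {a b : ℤ} {ξ : EuclideanSpace ℝ (Fin N)}
    (ha : 8 / 3 ≤ (2 : ℝ) ^ (-a) * ‖ξ‖) (hb : (2 : ℝ) ^ (-b) * ‖ξ‖ ≤ 3 / 4) :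
    ∑ k ∈ Finset.Ioo a b, blockSymbol φ ((2 : ℝ) ^ (-k) • ξ) = 1 := by
  have hξ : ξ ≠ 0 := by
    rintro rfl
    norm_num at ha
  have h1 : ∑' k : ℤ, φ ((2 : ℝ) ^ (-k) • ξ)
      = ∑ k ∈ Finset.Ioo a b, φ ((2 : ℝ) ^ (-k) • ξ) := by
    refine tsum_eq_sum fun k hk => ?_
    by_contra h
    exact hk (Finset.mem_Ioo.2 (hφ.mem_Ioo_of_ne_zero h ha hb))
  simp only [blockSymbol, tsum_dyadic_smul]
  rw [← Finset.sum_div, ← h1, div_self (hφ.tsum_pos hξ).ne']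

theorem contDiff_blockSymbol (hφ : IsDyadicGenerator φ) :
    ContDiff ℝ (⊤ : ℕ∞) (blockSymbol φ) := by
  have hsm : ∀ c : ℝ, ContDiff ℝ (⊤ : ℕ∞) fun ξ : EuclideanSpace ℝ (Fin N) => φ (c • ξ) :=
    fun c => (φ.smooth ⊤).comp (contDiff_const_smul c)
  rw [contDiff_iff_contDiffAt]
  intro ξ
  by_cases hξ : ξ ∈ tsupport φ
  · rw [hφ.tsupport_eq] at hξ
    have hU : {ξ : EuclideanSpace ℝ (Fin N) | 1 / 2 < ‖ξ‖ ∧ ‖ξ‖ < 3} ∈ nhds ξ := by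
      refine ((isOpen_lt continuous_const continuous_norm).inter
        (isOpen_lt continuous_norm continuous_const)).mem_nhds ⟨?_, ?_⟩
      · exact lt_of_lt_of_le (by norm_num) hξ.1
      · exact lt_of_le_of_lt hξ.2 (by norm_num)
    -- On this neighbourhood of the support one fixed finite set of indices carries the denominator,
    -- which is therefore smooth.
    have hsum : ∀ η : EuclideanSpace ℝ (Fin N), 1 / 2 < ‖η‖ ∧ ‖η‖ < 3 →
        ∑' k : ℤ, φ ((2 : ℝ) ^ (-k) • η) = ∑ k ∈ Finset.Ioo (-3 : ℤ) 3, φ ((2 : ℝ) ^ (-k) • η) := by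
      intro η hη
      refine tsum_eq_sum fun k hk => ?_
      by_contra h
      refine hk (Finset.mem_Ioo.2 (hφ.mem_Ioo_of_ne_zero h ?_ ?_))
      · norm_num; linarith [hη.1]
      · rw [show (2 : ℝ) ^ (-3 : ℤ) = 1 / 8 by norm_num [zpow_neg]]; linarith [hη.2]
    have heq : blockSymbol φ =ᶠ[nhds ξ]
        fun η => φ η / ∑ k ∈ Finset.Ioo (-3 : ℤ) 3, φ ((2 : ℝ) ^ (-k) • η) := by
      filter_upwards [hU] with η hη
      rw [blockSymbol, hsum η hη]
    refine ContDiffAt.congr_of_eventuallyEq ?_ heq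
    have hξ0 : ξ ≠ 0 := by
      rintro rfl
      norm_num at hξ
    refine ContDiffAt.div (φ.smooth ⊤).contDiffAt
      (ContDiff.sum fun k _ => hsm _).contDiffAt ?_
    have hmem := mem_of_mem_nhds hU
    rw [← hsum ξ hmem]
    exact (hφ.tsum_pos hξ0).ne'
  · have heq : blockSymbol φ =ᶠ[nhds ξ] fun _ => 0 := by
      filter_upwards [(isClosed_tsupport φ).isOpen_compl.mem_nhds hξ] with η hη
      rw [blockSymbol, image_eq_zero_of_notMem_tsupport hη, zero_div]
    exact contDiffAt_const.congr_of_eventuallyEq heq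

/-- The symbol of the low-pass filter `∑_{k < 0} Δ̇_k`. -/
def lowSymbol (φ : 𝓢(EuclideanSpace ℝ (Fin N), ℝ)) (ξ : EuclideanSpace ℝ (Fin N)) : ℝ :=
  if ‖ξ‖ < 7 / 10 then 1 else blockSymbol φ ((2 : ℝ) • ξ)

theorem lowSymbol_eq_of_lt (hφ : IsDyadicGenerator φ) {ξ : EuclideanSpace ℝ (Fin N)}
    (hξ : 2 / 3 ≤ ‖ξ‖) : lowSymbol φ ξ = blockSymbol φ ((2 : ℝ) • ξ) := by
  rw [lowSymbol]
  split_ifs with h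
  -- For 2/3 ≤ |ξ| ≤ 3/4 only the index -1 contributes to the partition of unity. The cut at 7/10
  -- lies strictly inside this overlap, so the two branches of `lowSymbol` glue smoothly.
  · have := sum_blockSymbol hφ (a := -2) (b := 0) (ξ := ξ) (by norm_num; linarith)
      (by norm_num; linarith)
    rw [show Finset.Ioo (-2 : ℤ) 0 = {-1} by rfl, Finset.sum_singleton] at this
    simpa using this.symm
  · rfl

theorem contDiff_lowSymbol (hφ : IsDyadicGenerator φ) : ContDiff ℝ (⊤ : ℕ∞) (lowSymbol φ) := by
  rw [contDiff_iff_contDiffAt]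
  intro ξ
  by_cases hξ : ‖ξ‖ < 7 / 10
  · have heq : lowSymbol φ =ᶠ[nhds ξ] fun _ => 1 := by
      filter_upwards [(isOpen_lt continuous_norm continuous_const).mem_nhds hξ] with η hη
      exact if_pos hη
    exact contDiffAt_const.congr_of_eventuallyEq heq
  · have heq : lowSymbol φ =ᶠ[nhds ξ] fun η => blockSymbol φ ((2 : ℝ) • η) := by
      have h : (2 / 3 : ℝ) < ‖ξ‖ := by linarith [not_lt.1 hξ]
      filter_upwards [(isOpen_lt continuous_const continuous_norm).mem_nhds h] with η hη
      exact lowSymbol_eq_of_lt hφ (le_of_lt hη)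
    exact (((contDiff_blockSymbol hφ).comp (contDiff_const_smul (2 : ℝ))).contDiffAt
      ).congr_of_eventuallyEq heq

theorem norm_lt_of_lowSymbol_ne_zero (hφ : IsDyadicGenerator φ) {ξ : EuclideanSpace ℝ (Fin N)}
    (h : lowSymbol φ ξ ≠ 0) : ‖ξ‖ < 4 / 3 := by
  rw [lowSymbol] at h
  split_ifs at h with h1
  · linarith
  · have := (blockSymbol_ne_zero hφ h).2
    rw [norm_smul, Real.norm_eq_abs, abs_two] at this
    linarith

/-- The telescoping relation S_1 - S_0 = Δ_0. Below 7/10 both low symbols are 1; up to 7/5 it is the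
partition of unity with the two indices -1 and 0; beyond, `lowSymbol φ ξ` vanishes because |2ξ| >
8/3. -/
theorem lowSymbol_half_sub (hφ : IsDyadicGenerator φ) (ξ : EuclideanSpace ℝ (Fin N)) :
    lowSymbol φ ((2 : ℝ)⁻¹ • ξ) - lowSymbol φ ξ = blockSymbol φ ξ := by
  have hn : ‖(2 : ℝ)⁻¹ • ξ‖ = ‖ξ‖ / 2 := by
    rw [norm_smul, norm_inv, Real.norm_eq_abs, abs_two]; ring
  have h2 : (2 : ℝ) • (2 : ℝ)⁻¹ • ξ = ξ := by rw [smul_smul]; simp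
  rcases lt_or_ge ‖ξ‖ (7 / 10) with h | h
  · rw [lowSymbol, lowSymbol, if_pos h, if_pos (by rw [hn]; linarith), sub_self]
    by_contra h0
    linarith [(blockSymbol_ne_zero hφ (Ne.symm h0)).1]
  rcases lt_or_ge ‖ξ‖ (7 / 5) with h' | h'
  · rw [lowSymbol, lowSymbol, if_neg (not_lt.2 h), if_pos (by rw [hn]; linarith)]
    have := sum_blockSymbol hφ (a := -2) (b := 1) (ξ := ξ) (by norm_num; linarith)
      (by norm_num; linarith)
    rw [show Finset.Ioo (-2 : ℤ) 1 = {-1, 0} by rfl, Finset.sum_pair (by norm_num)] at this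
    norm_num at this
    linarith
  · rw [lowSymbol, lowSymbol, if_neg (not_lt.2 h), if_neg (by rw [hn]; linarith), h2]
    have : blockSymbol φ ((2 : ℝ) • ξ) = 0 := by
      by_contra h0
      have := (blockSymbol_ne_zero hφ h0).2
      rw [norm_smul, Real.norm_eq_abs, abs_two] at this
      linarith
    rw [this, sub_zero]

/-- `blockSymbol` as a complex Schwartz function. -/
def blockSchwartz (hφ : IsDyadicGenerator φ) : 𝓢(EuclideanSpace ℝ (Fin N), ℂ) :=
  HasCompactSupport.toSchwartzMap (f := fun ξ => (blockSymbol φ ξ : ℂ))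
    (HasCompactSupport.of_support_subset_isCompact (isCompact_closedBall 0 (8 / 3)) fun ξ hξ => by
      have := (blockSymbol_ne_zero hφ (ξ := ξ) (by simpa using hξ)).2
      simpa using this.le)
    (Complex.ofRealCLM.contDiff.comp (contDiff_blockSymbol hφ))

/-- `lowSymbol` as a complex Schwartz function. -/
def lowSchwartz (hφ : IsDyadicGenerator φ) : 𝓢(EuclideanSpace ℝ (Fin N), ℂ) :=
  HasCompactSupport.toSchwartzMap (f := fun ξ => (lowSymbol φ ξ : ℂ))
    (HasCompactSupport.of_support_subset_isCompact (isCompact_closedBall 0 (4 / 3)) fun ξ hξ => by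
      have := norm_lt_of_lowSymbol_ne_zero hφ (ξ := ξ) (by simpa using hξ)
      simpa using this.le)
    (Complex.ofRealCLM.contDiff.comp (contDiff_lowSymbol hφ))

@[simp]
theorem blockSchwartz_apply (hφ : IsDyadicGenerator φ) (ξ : EuclideanSpace ℝ (Fin N)) :
    blockSchwartz hφ ξ = (blockSymbol φ ξ : ℂ) := rfl

@[simp]
theorem lowSchwartz_apply (hφ : IsDyadicGenerator φ) (ξ : EuclideanSpace ℝ (Fin N)) :
    lowSchwartz hφ ξ = (lowSymbol φ ξ : ℂ) := rfl

end Symbol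

/-! ### Scaling of multiplier kernels and the kernel form of frequency localization. -/

section Kernel

variable {V : Type*} [NormedAddCommGroup V] [InnerProductSpace ℝ V]

/-- The dilated symbol `σ(2^{-j} ξ)`. -/
def dilatedSymbol (σ : 𝓢(V, ℂ)) (j : ℤ) : 𝓢(V, ℂ) :=
  SchwartzMap.compCLMOfContinuousLinearEquiv ℂ
    (ContinuousLinearEquiv.smulLeft (Units.mk0 ((2 : ℝ) ^ (-j)) (by positivity))) σ

@[simp]
theorem dilatedSymbol_apply (σ : 𝓢(V, ℂ)) (j : ℤ) (ξ : V) :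
    dilatedSymbol σ j ξ = σ ((2 : ℝ) ^ (-j) • ξ) := rfl

variable [FiniteDimensional ℝ V] [MeasurableSpace V] [BorelSpace V]

/-- The kernel of the Fourier multiplier with symbol `σ(2^{-j} ξ)`. -/
def multiplierKernel (σ : 𝓢(V, ℂ)) (j : ℤ) : 𝓢(V, ℂ) := 𝓕⁻ (dilatedSymbol σ j)

theorem fourierInv_apply_eq (a : 𝓢(V, ℂ)) (x : V) :
    (𝓕⁻ a : 𝓢(V, ℂ)) x = ∫ ξ, (Real.fourierChar (inner ℝ ξ x) : ℂ) * a ξ := by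
  rw [SchwartzMap.fourierInv_coe, Real.fourierInv_eq]
  rfl

theorem multiplierKernel_apply (σ : 𝓢(V, ℂ)) (j : ℤ) (x : V) :
    multiplierKernel σ j x = (((2 : ℝ) ^ j) ^ (Module.finrank ℝ V) : ℝ) •
      (𝓕⁻ σ : 𝓢(V, ℂ)) ((2 : ℝ) ^ j • x) := by
  have h := Measure.integral_comp_smul volume
    (fun ξ : V => (Real.fourierChar (inner ℝ ξ ((2 : ℝ) ^ j • x)) : ℂ) * σ ξ) ((2 : ℝ) ^ (-j))
  rw [multiplierKernel, fourierInv_apply_eq, fourierInv_apply_eq]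
  simp only [dilatedSymbol_apply]
  have h2 : ∀ ξ : V, inner ℝ ((2 : ℝ) ^ (-j) • ξ) ((2 : ℝ) ^ j • x) = inner ℝ ξ x := fun ξ => by
    rw [inner_smul_left, inner_smul_right, ← mul_assoc]
    simp only [conj_trivial]
    rw [zpow_neg, inv_mul_cancel₀ (by positivity), one_mul]
  simp only [h2] at h
  rw [h]
  congr 1
  rw [zpow_neg, inv_pow, inv_inv, abs_of_pos (by positivity)]

theorem integral_norm_multiplierKernel (σ : 𝓢(V, ℂ)) (j : ℤ) :
    ∫ y, ‖multiplierKernel σ j y‖ = ∫ y, ‖(𝓕⁻ σ : 𝓢(V, ℂ)) y‖ := by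
  have h := Measure.integral_comp_smul volume
    (fun y : V => ‖(𝓕⁻ σ : 𝓢(V, ℂ)) y‖) ((2 : ℝ) ^ j)
  have hpos : 0 < ((2 : ℝ) ^ j) ^ (Module.finrank ℝ V) := by positivity
  simp only [multiplierKernel_apply, norm_smul]
  rw [integral_const_mul, h, Real.norm_eq_abs, abs_inv, smul_eq_mul, ← mul_assoc,
    mul_inv_cancel₀ (abs_pos.2 hpos.ne').ne', one_mul]

/-- Every power 2^{-q} or 2^{-j} gained from the Lipschitz bound comes from this scaling. -/
theorem integral_norm_mul_norm_multiplierKernel (σ : 𝓢(V, ℂ)) (j : ℤ) :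
    ∫ y, ‖y‖ * ‖multiplierKernel σ j y‖
      = (2 : ℝ) ^ (-j) * ∫ y, ‖y‖ * ‖(𝓕⁻ σ : 𝓢(V, ℂ)) y‖ := by
  have h := Measure.integral_comp_smul volume
    (fun y : V => ‖y‖ * ‖(𝓕⁻ σ : 𝓢(V, ℂ)) y‖) ((2 : ℝ) ^ j)
  have hpos : 0 < ((2 : ℝ) ^ j) ^ (Module.finrank ℝ V) := by positivity
  have h2 : ∀ y : V, ‖y‖ * ‖multiplierKernel σ j y‖
      = ((2 : ℝ) ^ (-j) * ‖((2 : ℝ) ^ j) ^ (Module.finrank ℝ V)‖) *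
        (‖(2 : ℝ) ^ j • y‖ * ‖(𝓕⁻ σ : 𝓢(V, ℂ)) ((2 : ℝ) ^ j • y)‖) := fun y => by
    rw [multiplierKernel_apply, norm_smul, norm_smul, Real.norm_of_nonneg (by positivity),
      Real.norm_of_nonneg (by positivity), zpow_neg]
    field_simp
  simp only [h2]
  rw [integral_const_mul, h, Real.norm_eq_abs, abs_inv, smul_eq_mul, mul_assoc,
    mul_inv_cancel_left₀ (abs_pos.2 hpos.ne').ne']

theorem integral_multiplierKernel (σ : 𝓢(V, ℂ)) (j : ℤ) :
    ∫ y, multiplierKernel σ j y = σ 0 := by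
  have h : (𝓕 (multiplierKernel σ j) : 𝓢(V, ℂ)) 0 = dilatedSymbol σ j 0 := by
    rw [multiplierKernel, FourierTransform.fourier_fourierInv_eq]
  rw [dilatedSymbol_apply, smul_zero] at h
  rw [← h, SchwartzMap.fourier_coe, Real.fourier_eq]
  simp

/-- A product of band-limited kernels is reproduced by a kernel whose symbol equals `1` on the
relevant frequencies. -/
theorem integral_fourierInv_mul_mul (a b d : 𝓢(V, ℂ))
    (h : ∀ ζ η, b ζ ≠ 0 → a η ≠ 0 → d (ζ - η) = 1) (x z w : V) :
    ∫ y, (𝓕⁻ b : 𝓢(V, ℂ)) (x - y) * (𝓕⁻ a : 𝓢(V, ℂ)) (y - z) * (𝓕⁻ d : 𝓢(V, ℂ)) (y - w)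
      = (𝓕⁻ b : 𝓢(V, ℂ)) (x - w) * (𝓕⁻ a : 𝓢(V, ℂ)) (w - z) := by
  set e : ℝ → ℂ := fun t => (Real.fourierChar t : ℂ) with he
  have hadd : ∀ s t, e (s + t) = e s * e t := fun s t => by
    simp [he, AddChar.map_add_eq_mul]
  have hnorm : ∀ t, ‖e t‖ = 1 := fun t => Circle.norm_coe _
  have hcont : Continuous e := by
    simp only [he]
    exact continuous_subtype_val.comp Real.continuous_fourierChar
  have hprod : ∀ y, (𝓕⁻ b : 𝓢(V, ℂ)) (x - y) * (𝓕⁻ a : 𝓢(V, ℂ)) (y - z)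
      = ∫ p : V × V, (e (inner ℝ p.1 (x - y)) * b p.1) * (e (inner ℝ p.2 (y - z)) * a p.2) :=
    fun y => by
      rw [fourierInv_apply_eq, fourierInv_apply_eq]
      exact (integral_prod_mul (μ := volume) (ν := volume)
        (fun ζ : V => e (inner ℝ ζ (x - y)) * b ζ) (fun η => e (inner ℝ η (y - z)) * a η)).symm
  have hd : ∀ ξ, d ξ = ∫ u, e (-inner ℝ u ξ) * (𝓕⁻ d : 𝓢(V, ℂ)) u := fun ξ => by
    have : d ξ = (𝓕 (𝓕⁻ d : 𝓢(V, ℂ)) : 𝓢(V, ℂ)) ξ := by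
      rw [FourierTransform.fourier_fourierInv_eq]
    rw [this, SchwartzMap.fourier_coe, Real.fourier_eq]
    rfl
  -- At fixed frequencies ζ, η, the integral in y is a phase times the Fourier transform of 𝓕⁻ d at
  -- ζ - η. This equals 1 wherever the amplitude is nonzero, and the remaining phase is the one at y
  -- = w.
  have hinner : ∀ p : V × V,
      ∫ y, (e (inner ℝ p.1 (x - y)) * b p.1) * (e (inner ℝ p.2 (y - z)) * a p.2)
        * (𝓕⁻ d : 𝓢(V, ℂ)) (y - w)
      = (e (inner ℝ p.1 (x - w)) * b p.1) * (e (inner ℝ p.2 (w - z)) * a p.2) := by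
    rintro ⟨ζ, η⟩
    simp only
    by_cases hb : b ζ = 0
    · simp [hb]
    by_cases ha : a η = 0
    · simp [ha]
    have h1 := h ζ η hb ha
    rw [hd, ← integral_sub_right_eq_self _ w] at h1
    calc ∫ y, (e (inner ℝ ζ (x - y)) * b ζ) * (e (inner ℝ η (y - z)) * a η)
          * (𝓕⁻ d : 𝓢(V, ℂ)) (y - w)
        = ∫ y, ((e (inner ℝ ζ (x - w)) * b ζ) * (e (inner ℝ η (w - z)) * a η)) *
          (e (-inner ℝ (y - w) (ζ - η)) * (𝓕⁻ d : 𝓢(V, ℂ)) (y - w)) := by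
          refine integral_congr_ae (Filter.Eventually.of_forall fun y => ?_)
          have e1 : e (inner ℝ ζ (x - y)) * e (inner ℝ η (y - z))
              = e (inner ℝ ζ (x - w)) * e (inner ℝ η (w - z)) * e (-inner ℝ (y - w) (ζ - η)) := by
            rw [← hadd, ← hadd, ← hadd]
            congr 1
            simp only [inner_sub_right, real_inner_comm ζ, real_inner_comm η]
            ring
          linear_combination (b ζ * a η * (𝓕⁻ d : 𝓢(V, ℂ)) (y - w)) * e1
      _ = _ := by rw [integral_const_mul, h1, mul_one]
  simp only [hprod]
  simp_rw [← integral_mul_const]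
  rw [integral_integral_swap]
  · simp_rw [hinner]
  · have hI : Integrable (fun q : V × (V × V) =>
        (𝓕⁻ d : 𝓢(V, ℂ)) (q.1 - w) * (b q.2.1 * a q.2.2)) (volume.prod volume) :=
      ((𝓕⁻ d : 𝓢(V, ℂ)).integrable.comp_sub_right w).mul_prod (b.integrable.mul_prod a.integrable)
    refine hI.mono ?_ (Filter.Eventually.of_forall fun q => ?_)
    · have := b.continuous
      have := a.continuous
      have := (𝓕⁻ d : 𝓢(V, ℂ)).continuous
      apply Continuous.aestronglyMeasurable
      simp only [Function.uncurry_def]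
      fun_prop
    · simp only [Function.uncurry, norm_mul, hnorm, one_mul]
      rw [mul_comm]

end Kernel

/-! ### Schwartz convolutions acting on Lipschitz and Lebesgue functions. -/

/-- A polynomial weight is absorbed into another Schwartz function, so integrability against
functions of linear growth reduces to the L^p membership of Schwartz functions. -/
theorem exists_schwartzMap_norm_eq_one_add_sq_mul {V : Type*} [NormedAddCommGroup V]
    [InnerProductSpace ℝ V] (κ : 𝓢(V, ℂ)) :
    ∃ κ' : 𝓢(V, ℂ), ∀ y, ‖κ' y‖ = (1 + ‖y‖ ^ 2) * ‖κ y‖ := by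
  have hg : (fun y : V => (1 + ‖y‖ ^ 2 : ℝ)).HasTemperateGrowth :=
    (Function.HasTemperateGrowth.const 1).add (Function.hasTemperateGrowth_norm_sq V)
  refine ⟨SchwartzMap.smulLeftCLM ℂ (fun y : V => (1 + ‖y‖ ^ 2 : ℝ)) κ, fun y => ?_⟩
  rw [SchwartzMap.smulLeftCLM_apply_apply hg, norm_smul, Real.norm_of_nonneg (by positivity)]

theorem one_add_le_two_mul_one_add_sq (t : ℝ) : 1 + t ≤ 2 * (1 + t ^ 2) := by
  nlinarith [sq_nonneg (2 * t - 1 / 2)]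

theorem LipschitzWith.norm_le_linear {V : Type*} [SeminormedAddCommGroup V] {L : ℝ≥0} {f : V → ℂ} 
    (hf : LipschitzWith L f) (x y : V) :
    ‖f y‖ ≤ (‖f x‖ + L) * (1 + ‖x - y‖) := by
  have h1 := hf.norm_sub_le y x
  have h2 := norm_le_norm_add_norm_sub' (f y) (f x)
  rw [norm_sub_rev y x] at h1
  nlinarith [norm_nonneg (f x), norm_nonneg (x - y), L.coe_nonneg]

section SchwartzConvolution

variable {V : Type*} [NormedAddCommGroup V] [InnerProductSpace ℝ V] [FiniteDimensional ℝ V]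
  [MeasurableSpace V] [BorelSpace V]

/-- Convolution with a Schwartz function. -/
def schwartzConv (κ : 𝓢(V, ℂ)) (u : V → ℂ) (x : V) : ℂ := ∫ y, κ (x - y) * u y

theorem schwartzConv_eq_swap (κ : 𝓢(V, ℂ)) (u : V → ℂ) (x : V) :
    schwartzConv κ u x = ∫ y, κ y * u (x - y) := by
  rw [schwartzConv, ← integral_sub_left_eq_self _ volume x]
  simp

theorem schwartzConv_congr_ae (κ : 𝓢(V, ℂ)) {u v : V → ℂ} (h : u =ᵐ[volume] v) :
    schwartzConv κ u = schwartzConv κ v := by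
  ext x
  refine integral_congr_ae ?_
  filter_upwards [h] with y hy
  rw [hy]

theorem integrable_one_add_norm_mul (κ : 𝓢(V, ℂ)) :
    Integrable (fun y => (1 + ‖y‖) * ‖κ y‖) volume := by
  obtain ⟨κ', hκ'⟩ := exists_schwartzMap_norm_eq_one_add_sq_mul κ
  refine (κ'.integrable.norm.const_mul 2).mono ?_ (Filter.Eventually.of_forall fun y => ?_)
  · have := κ.continuous
    exact Continuous.aestronglyMeasurable (by fun_prop)
  · rw [Real.norm_of_nonneg (by positivity), Real.norm_of_nonneg (by positivity), hκ', ← mul_assoc]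
    exact mul_le_mul_of_nonneg_right (one_add_le_two_mul_one_add_sq _) (norm_nonneg _)

theorem integrable_norm_mul (κ : 𝓢(V, ℂ)) : Integrable (fun y => ‖y‖ * ‖κ y‖) volume := by
  refine (integrable_one_add_norm_mul κ).mono ?_ (Filter.Eventually.of_forall fun y => ?_)
  · have := κ.continuous
    exact Continuous.aestronglyMeasurable (by fun_prop)
  · rw [Real.norm_of_nonneg (by positivity), Real.norm_of_nonneg (by positivity)]
    nlinarith [norm_nonneg (κ y)]

/-- Absolute convergence of `∫ κ(x-y) F(y) g(y) dy` for `F` of linear growth and `g ∈ L^p`. -/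
theorem integrable_schwartz_mul_mul (κ : 𝓢(V, ℂ)) {p : ℝ≥0∞} (hp : 1 ≤ p) {F g : V → ℂ}
    (hF : AEStronglyMeasurable F volume) (x : V) {c : ℝ} (hFc : ∀ y, ‖F y‖ ≤ c * (1 + ‖x - y‖))
    (hg : MemLp g p volume) : Integrable (fun y => κ (x - y) * (F y * g y)) volume := by
  obtain ⟨κ', hκ'⟩ := exists_schwartzMap_norm_eq_one_add_sq_mul κ
  have hc : 0 ≤ c := by
    have := (norm_nonneg (F x)).trans (hFc x)
    simpa using this
  have := ENNReal.HolderConjugate.conjExponent hp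
  have h1 : MemLp (fun y => κ' (x - y)) p.conjExponent volume :=
    (κ'.memLp p.conjExponent volume).comp_measurePreserving (Measure.measurePreserving_sub_left volume x)
  have h2 : MemLp (fun y => κ (x - y) * F y) p.conjExponent volume := by
    refine h1.of_le_mul (c := 2 * c) (AEStronglyMeasurable.mul ?_ hF)
      (Filter.Eventually.of_forall fun y => ?_)
    · have := κ.continuous
      exact Continuous.aestronglyMeasurable (by fun_prop)
    · rw [norm_mul, hκ']
      calc ‖κ (x - y)‖ * ‖F y‖ ≤ ‖κ (x - y)‖ * (c * (2 * (1 + ‖x - y‖ ^ 2))) := by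
            refine mul_le_mul_of_nonneg_left ((hFc y).trans ?_) (norm_nonneg _)
            exact mul_le_mul_of_nonneg_left (one_add_le_two_mul_one_add_sq _) hc
        _ = 2 * c * ((1 + ‖x - y‖ ^ 2) * ‖κ (x - y)‖) := by ring
  have h3 := hg.integrable_mul h2
  refine h3.congr (Filter.Eventually.of_forall fun y => ?_)
  simp only [Pi.mul_apply]
  ring

theorem integrable_schwartz_mul_lipschitz_mul (κ : 𝓢(V, ℂ)) {p : ℝ≥0∞} (hp : 1 ≤ p) {L : ℝ≥0}
    {f g : V → ℂ} (hf : LipschitzWith L f) (hg : MemLp g p volume) (x : V) :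
    Integrable (fun y => κ (x - y) * (f y * g y)) volume :=
  integrable_schwartz_mul_mul κ hp hf.continuous.aestronglyMeasurable x (hf.norm_le_linear x) hg

theorem integrable_schwartz_mul_memLp (κ : 𝓢(V, ℂ)) {p : ℝ≥0∞} (hp : 1 ≤ p)
    {g : V → ℂ} (hg : MemLp g p volume) (x : V) :
    Integrable (fun y => κ (x - y) * g y) volume := by
  simpa using integrable_schwartz_mul_lipschitz_mul κ hp (LipschitzWith.const (1 : ℂ)) hg x

theorem integrable_schwartz_mul_lipschitz (κ : 𝓢(V, ℂ)) {L : ℝ≥0}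
    {f : V → ℂ} (hf : LipschitzWith L f) (x : V) :
    Integrable (fun y => κ (x - y) * f y) volume := by
  simpa using integrable_schwartz_mul_lipschitz_mul κ le_top hf (memLp_top_const (1 : ℂ)) x

theorem enorm_schwartzConv_le (κ : 𝓢(V, ℂ)) (u : V → ℂ) (x : V) :
    ‖schwartzConv κ u x‖ₑ ≤ ∫⁻ y, ‖κ y‖ₑ * ‖u (x - y)‖ₑ := by
  rw [schwartzConv_eq_swap]
  refine (enorm_integral_le_lintegral_enorm _).trans (le_of_eq ?_)
  simp_rw [enorm_mul]

theorem lintegral_enorm_schwartz (κ : 𝓢(V, ℂ)) :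
    ∫⁻ y, ‖κ y‖ₑ = ENNReal.ofReal (∫ y, ‖κ y‖) := by
  rw [ofReal_integral_norm_eq_lintegral_enorm κ.integrable]

theorem eLpNorm_lintegral_schwartz_le (κ : 𝓢(V, ℂ)) {p : ℝ≥0∞} (hp : 1 ≤ p) {u : V → ℂ}
    (hu : AEStronglyMeasurable u volume) :
    eLpNorm (fun x => ∫⁻ y, ‖κ y‖ₑ * ‖u (x - y)‖ₑ) p volume
      ≤ ENNReal.ofReal (∫ y, ‖κ y‖) * eLpNorm u p volume := by
  have h := eLpNorm_lintegral_mul_sub_le (μ := volume) hp (k := fun y => ‖κ y‖ₑ)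
    (u := fun y => ‖u y‖ₑ) κ.continuous.measurable.enorm ?_ hu.enorm
  · rwa [lintegral_enorm_schwartz, eLpNorm_enorm] at h
  · rw [lintegral_enorm_schwartz]; exact ENNReal.ofReal_ne_top

theorem eLpNorm_schwartzConv_le (κ : 𝓢(V, ℂ)) {p : ℝ≥0∞} (hp : 1 ≤ p) {u : V → ℂ}
    (hu : AEStronglyMeasurable u volume) :
    eLpNorm (schwartzConv κ u) p volume ≤ ENNReal.ofReal (∫ y, ‖κ y‖) * eLpNorm u p volume :=
  (eLpNorm_mono_enorm fun x => by simpa using enorm_schwartzConv_le κ u x).trans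
    (eLpNorm_lintegral_schwartz_le κ hp hu)

theorem aestronglyMeasurable_schwartz_mul (κ : 𝓢(V, ℂ)) {u : V → ℂ}
    (hu : AEStronglyMeasurable u volume) :
    AEStronglyMeasurable (fun z : V × V => κ (z.1 - z.2) * u z.2) (volume.prod volume) := by
  have := κ.continuous
  exact (Continuous.aestronglyMeasurable (by fun_prop)).mul hu.comp_snd

theorem memLp_schwartzConv (κ : 𝓢(V, ℂ)) {p : ℝ≥0∞} (hp : 1 ≤ p) {u : V → ℂ}
    (hu : MemLp u p volume) : MemLp (schwartzConv κ u) p volume :=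
  ⟨(aestronglyMeasurable_schwartz_mul κ hu.1).integral_prod_right',
    (eLpNorm_schwartzConv_le κ hp hu.1).trans_lt (ENNReal.mul_lt_top ENNReal.ofReal_lt_top hu.2)⟩

theorem memLp_integral_norm_schwartz_mul (κ : 𝓢(V, ℂ)) {p : ℝ≥0∞} (hp : 1 ≤ p) {u : V → ℂ}
    (hu : MemLp u p volume) : MemLp (fun x => ∫ y, ‖κ (x - y) * u y‖) p volume := by
  refine ⟨(aestronglyMeasurable_schwartz_mul κ hu.1).norm.integral_prod_right', ?_⟩
  refine lt_of_le_of_lt (eLpNorm_mono_enorm fun x => ?_) ((eLpNorm_lintegral_schwartz_le κ hp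
    hu.1).trans_lt (ENNReal.mul_lt_top ENNReal.ofReal_lt_top hu.2))
  rw [← integral_sub_left_eq_self _ volume x]
  refine (enorm_integral_le_lintegral_enorm _).trans (le_of_eq ?_)
  simp

theorem lipschitzWith_schwartzConv (κ : 𝓢(V, ℂ)) {L : ℝ≥0} {f : V → ℂ} (hf : LipschitzWith L f) :
    LipschitzWith (Real.toNNReal (∫ y, ‖κ y‖) * L) (schwartzConv κ f) := by
  have hint : ∀ x, Integrable (fun y => κ y * f (x - y)) volume := fun x => by
    simpa using (integrable_schwartz_mul_lipschitz κ hf x).comp_sub_left x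
  refine LipschitzWith.of_dist_le_mul fun x y => ?_
  rw [dist_eq_norm, schwartzConv_eq_swap, schwartzConv_eq_swap,
    ← integral_sub (hint x) (hint y), NNReal.coe_mul, Real.coe_toNNReal _ (by positivity), mul_assoc,
    ← integral_mul_const]
  refine norm_integral_le_of_norm_le (κ.integrable.norm.mul_const _)
    (Filter.Eventually.of_forall fun z => ?_)
  rw [← mul_sub, norm_mul]
  refine mul_le_mul_of_nonneg_left ?_ (norm_nonneg _)
  have := hf.dist_le_mul (x - z) (y - z)
  rwa [dist_sub_right, dist_eq_norm] at this

/-- The difference is ∫ κ(y) (f(x-y) - f(x)) dy. With ∫ κ = 0 this bounds a dyadic block of f; with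
∫ κ = 1 it bounds the error of the low-pass filter. -/
theorem norm_schwartzConv_sub_le (κ : 𝓢(V, ℂ)) {L : ℝ≥0} {f : V → ℂ} (hf : LipschitzWith L f)
    (x : V) : ‖schwartzConv κ f x - (∫ y, κ y) * f x‖ ≤ L * ∫ y, ‖y‖ * ‖κ y‖ := by
  have hint : Integrable (fun y => κ y * f (x - y)) volume := by
    simpa using (integrable_schwartz_mul_lipschitz κ hf x).comp_sub_left x
  rw [schwartzConv_eq_swap, ← integral_mul_const, ← integral_sub hint (κ.integrable.mul_const _),
    ← integral_const_mul]
  refine norm_integral_le_of_norm_le ((integrable_norm_mul κ).const_mul _)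
    (Filter.Eventually.of_forall fun y => ?_)
  rw [← mul_sub, norm_mul]
  have := hf.norm_sub_le (x - y) x
  rw [sub_sub_cancel_left, norm_neg] at this
  nlinarith [norm_nonneg (κ y)]

/-- Fubini with f outermost: two functions u can then be compared through the inner integral alone,
where f no longer appears. -/
theorem schwartzConv_mul_schwartzConv_eq (A B : 𝓢(V, ℂ)) {p : ℝ≥0∞} (hp : 1 ≤ p) {L : ℝ≥0}
    {f u : V → ℂ} (hf : LipschitzWith L f) (hu : MemLp u p volume) (x : V) :
    schwartzConv B (fun y => schwartzConv A f y * u y) x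
      = ∫ z, f z * ∫ y, B (x - y) * A (y - z) * u y := by
  have hI : Integrable (fun q : V × V => (B (x - q.1) * u q.1) * (A (q.1 - q.2) * f q.2))
      (volume.prod volume) := by
    -- Since |f(z)| ≤ (|f(y)| + L)(1 + |y-z|), the integrand is dominated by a convolution
    -- integrand: the first factor goes with B and u, the second with A.
    have h1 : Integrable (fun y => B (x - y) * (((‖f y‖ + L : ℝ) : ℂ) * u y)) volume := by
      refine integrable_schwartz_mul_mul B hp ?_ x (c := ‖f x‖ + 2 * L) (fun y => ?_) hu
      · have := hf.continuous
        exact Continuous.aestronglyMeasurable (by fun_prop)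
      · rw [Complex.norm_real, Real.norm_of_nonneg (by positivity)]
        have := hf.norm_le_linear x y
        nlinarith [norm_nonneg (x - y), L.coe_nonneg]
    have h2 : Integrable (fun y => (1 + ‖y‖) * ‖A (-y)‖) volume := by
      simpa using (integrable_one_add_norm_mul A).comp_neg
    have h3 := (h1.norm.convolution_integrand (ContinuousLinearMap.mul ℝ ℝ) h2).swap
    refine h3.mono ?_ (Filter.Eventually.of_forall fun q => ?_)
    · have := B.continuous
      have := A.continuous
      have := hf.continuous
      exact AEStronglyMeasurable.mul (AEStronglyMeasurable.mul
        (Continuous.aestronglyMeasurable (by fun_prop)) hu.1.comp_fst)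
        (Continuous.aestronglyMeasurable (by fun_prop))
    · simp only [Function.comp, Prod.fst_swap, Prod.snd_swap, ContinuousLinearMap.mul_apply',
        norm_mul, neg_sub, norm_norm, Complex.norm_real]
      rw [Real.norm_of_nonneg (by positivity : 0 ≤ ‖f q.1‖ + (L : ℝ)),
        Real.norm_of_nonneg (by positivity : 0 ≤ 1 + ‖q.2 - q.1‖), norm_sub_rev q.2 q.1]
      calc ‖B (x - q.1)‖ * ‖u q.1‖ * (‖A (q.1 - q.2)‖ * ‖f q.2‖)
          ≤ ‖B (x - q.1)‖ * ‖u q.1‖ * (‖A (q.1 - q.2)‖ *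
            ((‖f q.1‖ + L) * (1 + ‖q.1 - q.2‖))) := by
            gcongr
            exact hf.norm_le_linear q.1 q.2
        _ = _ := by ring
  calc schwartzConv B (fun y => schwartzConv A f y * u y) x
      = ∫ y, ∫ z, (B (x - y) * u y) * (A (y - z) * f z) := by
        refine integral_congr_ae (Filter.Eventually.of_forall fun y => ?_)
        simp only [schwartzConv]
        rw [integral_const_mul]
        ring
    _ = ∫ z, ∫ y, (B (x - y) * u y) * (A (y - z) * f z) := integral_integral_swap hI
    _ = _ := by
        refine integral_congr_ae (Filter.Eventually.of_forall fun z => ?_)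
        simp only
        rw [← integral_const_mul]
        refine integral_congr_ae (Filter.Eventually.of_forall fun y => ?_)
        simp only
        ring

/-- Frequency localization: if `d = 1` on `supp b - supp a`, then only the part of `g` with
frequencies in the support of `d` contributes to `𝓕⁻ b * ((𝓕⁻ a * f) g)`. -/
theorem schwartzConv_mul_localize (a b d : 𝓢(V, ℂ))
    (h : ∀ ζ η, b ζ ≠ 0 → a η ≠ 0 → d (ζ - η) = 1) {p : ℝ≥0∞} (hp : 1 ≤ p) {L : ℝ≥0}
    {f g : V → ℂ} (hf : LipschitzWith L f) (hg : MemLp g p volume) (x : V) :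
    schwartzConv (𝓕⁻ b) (fun y => schwartzConv (𝓕⁻ a) f y * g y) x
      = schwartzConv (𝓕⁻ b) (fun y => schwartzConv (𝓕⁻ a) f y * schwartzConv (𝓕⁻ d) g y) x := by
  rw [schwartzConv_mul_schwartzConv_eq _ _ hp hf hg,
    schwartzConv_mul_schwartzConv_eq _ _ hp hf (memLp_schwartzConv _ hp hg)]
  refine integral_congr_ae (Filter.Eventually.of_forall fun z => ?_)
  simp only
  congr 1
  set A : 𝓢(V, ℂ) := 𝓕⁻ a
  set B : 𝓢(V, ℂ) := 𝓕⁻ b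
  set D : 𝓢(V, ℂ) := 𝓕⁻ d
  have hAc := A.continuous
  have hBc := B.continuous
  have hDc := D.continuous
  have hmeas : AEStronglyMeasurable
      (fun q : V × V => (B (x - q.1) * A (q.1 - z)) * (D (q.1 - q.2) * g q.2))
      (volume.prod volume) :=
    (Continuous.aestronglyMeasurable (by fun_prop)).mul (aestronglyMeasurable_schwartz_mul D hg.1)
  have hI : Integrable (fun q : V × V => (B (x - q.1) * A (q.1 - z)) * (D (q.1 - q.2) * g q.2))
      (volume.prod volume) := by
    rw [integrable_prod_iff hmeas]
    refine ⟨Filter.Eventually.of_forall fun y =>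
      (integrable_schwartz_mul_memLp D hp hg y).const_mul (B (x - y) * A (y - z)), ?_⟩
    -- With z fixed, A(y - z) is merely a bounded factor. The rest is B against |D| * |g|, which
    -- lies in L^p by Young.
    obtain ⟨c, hc⟩ : ∃ c, ∀ y, ‖A y‖ ≤ c := by
      obtain ⟨c, -, hc⟩ := A.decay 0 0
      exact ⟨c, fun y => by simpa using hc y⟩
    have hc0 : 0 ≤ c := (norm_nonneg _).trans (hc 0)
    have h1 := integrable_schwartz_mul_mul B hp (F := fun y => A (y - z))
      (Continuous.aestronglyMeasurable (by fun_prop)) x (c := c)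
      (fun y => (hc _).trans (le_mul_of_one_le_right hc0 (by linarith [norm_nonneg (x - y)])))
      (memLp_integral_norm_schwartz_mul D hp hg).ofReal
    refine h1.norm.congr (Filter.Eventually.of_forall fun y => ?_)
    simp only [norm_mul _ (D _ * g _)]
    rw [integral_const_mul]
    simp only [norm_mul, mul_assoc]
    congr 2
    exact RCLike.norm_of_nonneg (by positivity)
  symm
  calc ∫ y, B (x - y) * A (y - z) * schwartzConv D g y
      = ∫ y, ∫ w, (B (x - y) * A (y - z)) * (D (y - w) * g w) := by
        simp only [schwartzConv, integral_const_mul]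
    _ = ∫ w, ∫ y, (B (x - y) * A (y - z)) * (D (y - w) * g w) := integral_integral_swap hI
    _ = ∫ w, B (x - w) * A (w - z) * g w := by
        refine integral_congr_ae (Filter.Eventually.of_forall fun w => ?_)
        simp only [← mul_assoc]
        rw [integral_mul_const, integral_fourierInv_mul_mul a b d h]

end SchwartzConvolution

/-! ### The first-moment bound for commutators with a convolution. -/

section Commutator

variable {V : Type*} [NormedAddCommGroup V] [InnerProductSpace ℝ V] [FiniteDimensional ℝ V]
  [MeasurableSpace V] [BorelSpace V]

theorem aestronglyMeasurable_schwartzConv (κ : 𝓢(V, ℂ)) {u : V → ℂ}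
    (hu : AEStronglyMeasurable u volume) : AEStronglyMeasurable (schwartzConv κ u) volume :=
  (aestronglyMeasurable_schwartz_mul κ hu).integral_prod_right'

theorem enorm_commutator_schwartzConv_le (κ : 𝓢(V, ℂ)) {p : ℝ≥0∞} (hp : 1 ≤ p) {L : ℝ≥0}
    {f u : V → ℂ} (hf : LipschitzWith L f) (hu : MemLp u p volume) (x : V) :
    ‖f x * schwartzConv κ u x - schwartzConv κ (fun y => f y * u y) x‖ₑ
      ≤ L * ∫⁻ y, (‖y‖ₑ * ‖κ y‖ₑ) * ‖u (x - y)‖ₑ := by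
  have h1 := (integrable_schwartz_mul_memLp κ hp hu x).const_mul (f x)
  have h2 := integrable_schwartz_mul_lipschitz_mul κ hp hf hu x
  rw [schwartzConv, schwartzConv, ← integral_const_mul, ← integral_sub h1 h2,
    ← integral_sub_left_eq_self _ volume x]
  refine (enorm_integral_le_lintegral_enorm _).trans ?_
  rw [← lintegral_const_mul' _ _ ENNReal.coe_ne_top]
  refine lintegral_mono fun y => ?_
  rw [sub_sub_cancel, show f x * (κ y * u (x - y)) - κ y * (f (x - y) * u (x - y))
    = (f x - f (x - y)) * (κ y * u (x - y)) by ring, enorm_mul, enorm_mul]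
  have h3 : ‖f x - f (x - y)‖ₑ ≤ L * ‖y‖ₑ := by
    have := hf x (x - y)
    rwa [edist_eq_enorm_sub, edist_eq_enorm_sub, sub_sub_cancel] at this
  calc ‖f x - f (x - y)‖ₑ * (‖κ y‖ₑ * ‖u (x - y)‖ₑ)
      ≤ (L * ‖y‖ₑ) * (‖κ y‖ₑ * ‖u (x - y)‖ₑ) := by gcongr
    _ = _ := by ring

/-- Young's inequality with the kernel |y| |κ(y)|. Membership in L^{p₁} only ensures convergence of
the integrals; the bound is measured in L^p and may be infinite. -/
theorem eLpNorm_commutator_schwartzConv_le (κ : 𝓢(V, ℂ)) {p p₁ : ℝ≥0∞} (hp : 1 ≤ p)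
    (hp₁ : 1 ≤ p₁) {L : ℝ≥0} {f u : V → ℂ} (hf : LipschitzWith L f) (hu : MemLp u p₁ volume) :
    eLpNorm (fun x => f x * schwartzConv κ u x - schwartzConv κ (fun y => f y * u y) x) p volume
      ≤ L * (ENNReal.ofReal (∫ y, ‖y‖ * ‖κ y‖) * eLpNorm u p volume) := by
  have hk : ∫⁻ y, ‖y‖ₑ * ‖κ y‖ₑ = ENNReal.ofReal (∫ y, ‖y‖ * ‖κ y‖) := by
    rw [ofReal_integral_eq_lintegral_ofReal (integrable_norm_mul κ)
      (Filter.Eventually.of_forall fun y => by positivity)]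
    refine lintegral_congr fun y => ?_
    rw [ENNReal.ofReal_mul (norm_nonneg _), ofReal_norm, ofReal_norm]
  have h := eLpNorm_lintegral_mul_sub_le (μ := volume) hp (k := fun y => ‖y‖ₑ * ‖κ y‖ₑ)
    (u := fun y => ‖u y‖ₑ) (measurable_enorm.mul κ.continuous.measurable.enorm)
    (by rw [hk]; exact ENNReal.ofReal_ne_top) hu.1.enorm
  rw [hk, eLpNorm_enorm] at h
  refine (eLpNorm_le_mul_eLpNorm_of_ae_le_mul' (c := L) (Filter.Eventually.of_forall fun x => ?_)
    p).trans (mul_le_mul_right h _)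
  simpa using enorm_commutator_schwartzConv_le κ hp₁ hf hu x

end Commutator

/-! ### Low-pass filters, widened blocks and frequency localization of products. -/

section Dyadic

variable {N : ℕ} {φ : 𝓢(EuclideanSpace ℝ (Fin N), ℝ)}

theorem dyadicKernel_eq (hφ : IsDyadicGenerator φ) (q : ℤ) :
    dyadicKernel φ q = multiplierKernel (blockSchwartz hφ) q := by
  rw [dyadicKernel, multiplierKernel, SchwartzMap.fourierInv_coe]
  congr 1
  ext ξ
  rw [dyadicSymbol_eq, dilatedSymbol_apply, blockSchwartz_apply]

theorem dyadicBlock_eq (hφ : IsDyadicGenerator φ) (q : ℤ) (u : EuclideanSpace ℝ (Fin N) → ℂ) :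
    dyadicBlock φ q u = schwartzConv (multiplierKernel (blockSchwartz hφ) q) u := by
  ext x
  rw [schwartzConv_eq_swap, dyadicBlock, dyadicKernel_eq hφ, convolution_def]
  rfl

theorem blockSymbol_zero (hφ : IsDyadicGenerator φ) : blockSymbol φ 0 = 0 := by
  by_contra h
  have := (blockSymbol_ne_zero hφ h).1
  norm_num at this

theorem lowSymbol_zero (φ : 𝓢(EuclideanSpace ℝ (Fin N), ℝ)) : lowSymbol φ 0 = 1 :=
  if_pos (by norm_num)

theorem norm_dyadicBlock_lipschitz_le (hφ : IsDyadicGenerator φ) {L : ℝ≥0}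
    {f : EuclideanSpace ℝ (Fin N) → ℂ} (hf : LipschitzWith L f) (j : ℤ)
    (x : EuclideanSpace ℝ (Fin N)) :
    ‖dyadicBlock φ j f x‖ ≤ L * ((2 : ℝ) ^ (-j) *
      ∫ y, ‖y‖ * ‖(𝓕⁻ (blockSchwartz hφ) : 𝓢(EuclideanSpace ℝ (Fin N), ℂ)) y‖) := by
  have h := norm_schwartzConv_sub_le (multiplierKernel (blockSchwartz hφ) j) hf x
  rw [integral_multiplierKernel, blockSchwartz_apply, blockSymbol_zero hφ, Complex.ofReal_zero,
    zero_mul, sub_zero, integral_norm_mul_norm_multiplierKernel] at h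
  rwa [dyadicBlock_eq hφ]

/-- The low-pass filter `∑_{k < j} Δ̇_k`. -/
def lowBlock (hφ : IsDyadicGenerator φ) (j : ℤ) (u : EuclideanSpace ℝ (Fin N) → ℂ) :
    EuclideanSpace ℝ (Fin N) → ℂ :=
  schwartzConv (multiplierKernel (lowSchwartz hφ) j) u

theorem norm_sub_lowBlock_le (hφ : IsDyadicGenerator φ) {L : ℝ≥0}
    {f : EuclideanSpace ℝ (Fin N) → ℂ} (hf : LipschitzWith L f) (j : ℤ)
    (x : EuclideanSpace ℝ (Fin N)) :
    ‖f x - lowBlock hφ j f x‖ ≤ L * ((2 : ℝ) ^ (-j) *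
      ∫ y, ‖y‖ * ‖(𝓕⁻ (lowSchwartz hφ) : 𝓢(EuclideanSpace ℝ (Fin N), ℂ)) y‖) := by
  have h := norm_schwartzConv_sub_le (multiplierKernel (lowSchwartz hφ) j) hf x
  rwa [integral_multiplierKernel, lowSchwartz_apply, lowSymbol_zero, Complex.ofReal_one,
    one_mul, integral_norm_mul_norm_multiplierKernel, norm_sub_rev] at h

theorem multiplierKernel_low_succ (hφ : IsDyadicGenerator φ) (j : ℤ) :
    multiplierKernel (lowSchwartz hφ) (j + 1)
      = multiplierKernel (lowSchwartz hφ) j + multiplierKernel (blockSchwartz hφ) j := by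
  rw [multiplierKernel, multiplierKernel, multiplierKernel, ← FourierTransform.fourierInv_add]
  congr 1
  ext ξ
  have h := lowSymbol_half_sub hφ ((2 : ℝ) ^ (-j) • ξ)
  rw [smul_smul, show (2 : ℝ)⁻¹ * (2 : ℝ) ^ (-j) = (2 : ℝ) ^ (-(j + 1)) by
    rw [neg_add, zpow_add₀ two_ne_zero, mul_comm, zpow_neg_one]] at h
  rw [add_apply, dilatedSymbol_apply, dilatedSymbol_apply, dilatedSymbol_apply,
    lowSchwartz_apply, lowSchwartz_apply, blockSchwartz_apply, ← h]
  push_cast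
  ring

theorem lowBlock_succ (hφ : IsDyadicGenerator φ) {L : ℝ≥0}
    {f : EuclideanSpace ℝ (Fin N) → ℂ} (hf : LipschitzWith L f) (j : ℤ)
    (x : EuclideanSpace ℝ (Fin N)) :
    lowBlock hφ (j + 1) f x = lowBlock hφ j f x + dyadicBlock φ j f x := by
  rw [dyadicBlock_eq hφ, lowBlock, lowBlock, multiplierKernel_low_succ, schwartzConv, schwartzConv,
    schwartzConv, ← integral_add (integrable_schwartz_mul_lipschitz _ hf x)
      (integrable_schwartz_mul_lipschitz _ hf x)]
  simp only [add_apply, add_mul]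

theorem lowBlock_add_sum (hφ : IsDyadicGenerator φ) {L : ℝ≥0}
    {f : EuclideanSpace ℝ (Fin N) → ℂ} (hf : LipschitzWith L f) (j : ℤ) (n : ℕ)
    (x : EuclideanSpace ℝ (Fin N)) :
    lowBlock hφ (j + n) f x
      = lowBlock hφ j f x + ∑ i ∈ Finset.range n, dyadicBlock φ (j + i) f x := by
  induction n with
  | zero => simp
  | succ n ih =>
    rw [Finset.sum_range_succ, ← add_assoc, ← ih, Nat.cast_succ, ← add_assoc,
      lowBlock_succ hφ hf]

/-- The symbol of `∑_{|k| ≤ 2} Δ̇_{j + k}`. -/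
def wideSymbol (hφ : IsDyadicGenerator φ) (j : ℤ) : 𝓢(EuclideanSpace ℝ (Fin N), ℂ) :=
  ∑ k ∈ Finset.Icc (-2 : ℤ) 2, dilatedSymbol (blockSchwartz hφ) (j + k)

/-- The operator `∑_{|k| ≤ 2} Δ̇_{j + k}`. -/
def wideBlock (hφ : IsDyadicGenerator φ) (j : ℤ) (u : EuclideanSpace ℝ (Fin N) → ℂ) :
    EuclideanSpace ℝ (Fin N) → ℂ :=
  schwartzConv (𝓕⁻ (wideSymbol hφ j)) u

theorem wideBlock_eq_sum (hφ : IsDyadicGenerator φ) (j : ℤ) {p : ℝ≥0∞} (hp : 1 ≤ p)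
    {u : EuclideanSpace ℝ (Fin N) → ℂ} (hu : MemLp u p volume) :
    wideBlock hφ j u = ∑ k ∈ Finset.Icc (-2 : ℤ) 2, dyadicBlock φ (j + k) u := by
  ext x
  have h1 : (𝓕⁻ (wideSymbol hφ j) : 𝓢(EuclideanSpace ℝ (Fin N), ℂ))
      = ∑ k ∈ Finset.Icc (-2 : ℤ) 2, multiplierKernel (blockSchwartz hφ) (j + k) := by
    rw [wideSymbol, FourierTransform.fourierInv_sum]
    rfl
  rw [wideBlock, h1, schwartzConv, Finset.sum_apply]
  simp only [dyadicBlock_eq hφ, schwartzConv]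
  rw [← integral_finsetSum _ fun k _ => integrable_schwartz_mul_memLp _ hp hu x]
  refine integral_congr_ae (Filter.Eventually.of_forall fun y => ?_)
  simp only [sum_apply, Finset.sum_mul]

theorem eLpNorm_wideBlock_le (hφ : IsDyadicGenerator φ) (j : ℤ) {p p₁ : ℝ≥0∞} (hp : 1 ≤ p)
    (hp₁ : 1 ≤ p₁) {u : EuclideanSpace ℝ (Fin N) → ℂ} (hu : MemLp u p₁ volume) :
    eLpNorm (wideBlock hφ j u) p volume
      ≤ ∑ k ∈ Finset.Icc (-2 : ℤ) 2, eLpNorm (dyadicBlock φ (j + k) u) p volume := by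
  rw [wideBlock_eq_sum hφ j hp₁ hu]
  refine eLpNorm_sum_le (fun k _ => ?_) hp
  rw [dyadicBlock_eq hφ]
  exact aestronglyMeasurable_schwartzConv _ hu.1

/-- The bounds 1/3 and 6 are those for which only the indices j-2, …, j+2 meet ξ: 8 · 1/3 = 8/3 and
6/8 = 3/4. -/
theorem wideSymbol_eq_one (hφ : IsDyadicGenerator φ) {j : ℤ} {ξ : EuclideanSpace ℝ (Fin N)}
    (h1 : 1 / 3 ≤ (2 : ℝ) ^ (-j) * ‖ξ‖) (h2 : (2 : ℝ) ^ (-j) * ‖ξ‖ ≤ 6) :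
    wideSymbol hφ j ξ = 1 := by
  have h := sum_blockSymbol hφ (a := j - 3) (b := j + 3) (ξ := ξ) ?_ ?_
  · rw [wideSymbol, sum_apply]
    simp only [dilatedSymbol_apply, blockSchwartz_apply]
    rw [← Complex.ofReal_sum, ← Complex.ofReal_one, ← h]
    congr 1
    refine Finset.sum_nbij' (fun k => j + k) (fun k => k - j) ?_ ?_ ?_ ?_ ?_
    all_goals intro k hk
    all_goals simp only [Finset.mem_Icc, Finset.mem_Ioo] at hk ⊢
    all_goals omega
  · rw [show -(j - 3) = -j + 3 by ring, zpow_add₀ two_ne_zero, mul_right_comm,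
      show (2 : ℝ) ^ (3 : ℤ) = 8 by norm_num]
    linarith
  · rw [show -(j + 3) = -j + -3 by ring, zpow_add₀ two_ne_zero, mul_right_comm,
      show (2 : ℝ) ^ (-3 : ℤ) = 1 / 8 by norm_num [zpow_neg]]
    linarith

/-- In units of 2^q the output frequency lies in (3/4, 8/3) and that of the low part of f below 1/3.
The frequency of g thus lies between 5/12 and 3, where the wide symbol is 1. -/
theorem dyadicBlock_lowBlock_mul_localize (hφ : IsDyadicGenerator φ) (q : ℤ) {p : ℝ≥0∞}
    (hp : 1 ≤ p) {L : ℝ≥0} {f g : EuclideanSpace ℝ (Fin N) → ℂ} (hf : LipschitzWith L f)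
    (hg : MemLp g p volume) (x : EuclideanSpace ℝ (Fin N)) :
    dyadicBlock φ q (fun y => lowBlock hφ (q - 2) f y * g y) x
      = dyadicBlock φ q (fun y => lowBlock hφ (q - 2) f y * wideBlock hφ q g y) x := by
  rw [dyadicBlock_eq hφ, dyadicBlock_eq hφ]
  refine schwartzConv_mul_localize (dilatedSymbol (lowSchwartz hφ) (q - 2))
    (dilatedSymbol (blockSchwartz hφ) q) (wideSymbol hφ q) (fun ζ η hb ha => ?_) hp hf hg x
  rw [dilatedSymbol_apply, blockSchwartz_apply, Complex.ofReal_ne_zero] at hb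
  rw [dilatedSymbol_apply, lowSchwartz_apply, Complex.ofReal_ne_zero] at ha
  have hb' := blockSymbol_smul_ne_zero hφ hb
  have ha' := norm_lt_of_lowSymbol_ne_zero hφ ha
  rw [norm_smul, norm_zpow, Real.norm_eq_abs, abs_two, show -(q - 2) = -q + 2 by ring,
    zpow_add₀ two_ne_zero, mul_right_comm, show (2 : ℝ) ^ (2 : ℤ) = 4 by norm_num] at ha'
  have hpos : (0 : ℝ) < (2 : ℝ) ^ (-q) := by positivity
  have t1 := mul_le_mul_of_nonneg_left (norm_sub_norm_le ζ η) hpos.le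
  have t2 := mul_le_mul_of_nonneg_left (norm_sub_le ζ η) hpos.le
  rw [mul_sub] at t1
  rw [mul_add] at t2
  exact wideSymbol_eq_one hφ (by linarith) (by linarith)

/-- The same arithmetic in units of 2^j, with the roles exchanged: the gap of 3 puts the output
frequency below 2^{-3} · 8/3 = 1/3. -/
theorem dyadicBlock_dyadicBlock_mul_localize (hφ : IsDyadicGenerator φ) {q j : ℤ} (hqj : q + 3 ≤ j)
    {p : ℝ≥0∞} (hp : 1 ≤ p) {L : ℝ≥0} {f g : EuclideanSpace ℝ (Fin N) → ℂ}
    (hf : LipschitzWith L f) (hg : MemLp g p volume) (x : EuclideanSpace ℝ (Fin N)) :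
    dyadicBlock φ q (fun y => dyadicBlock φ j f y * g y) x
      = dyadicBlock φ q (fun y => dyadicBlock φ j f y * wideBlock hφ j g y) x := by
  simp only [dyadicBlock_eq hφ]
  refine schwartzConv_mul_localize (dilatedSymbol (blockSchwartz hφ) j)
    (dilatedSymbol (blockSchwartz hφ) q) (wideSymbol hφ j) (fun ζ η hb ha => ?_) hp hf hg x
  rw [dilatedSymbol_apply, blockSchwartz_apply, Complex.ofReal_ne_zero] at ha hb
  have hb' := (blockSymbol_smul_ne_zero hφ hb).2
  have ha' := blockSymbol_smul_ne_zero hφ ha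
  have hb'' : (2 : ℝ) ^ (-j) * ‖ζ‖ ≤ 1 / 3 := by
    refine two_zpow_mul_le (norm_nonneg ζ) (n := -q + -3) (by omega) ?_
    rw [zpow_add₀ two_ne_zero, mul_right_comm,
      show (2 : ℝ) ^ (-3 : ℤ) = 1 / 8 by norm_num [zpow_neg]]
    linarith
  have hpos : (0 : ℝ) < (2 : ℝ) ^ (-j) := by positivity
  have t1 := mul_le_mul_of_nonneg_left (norm_sub_norm_le η ζ) hpos.le
  have t2 := mul_le_mul_of_nonneg_left (norm_sub_le ζ η) hpos.le
  rw [mul_sub, norm_sub_rev] at t1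
  rw [mul_add] at t2
  exact wideSymbol_eq_one hφ (by linarith) (by linarith)

/-- The case f = 1 of the low-frequency localization, since the low-pass filter fixes constants. -/
theorem dyadicBlock_wideBlock (hφ : IsDyadicGenerator φ) (q : ℤ) {p : ℝ≥0∞}
    (hp : 1 ≤ p) {g : EuclideanSpace ℝ (Fin N) → ℂ} (hg : MemLp g p volume)
    (x : EuclideanSpace ℝ (Fin N)) :
    dyadicBlock φ q (wideBlock hφ q g) x = dyadicBlock φ q g x := by
  have h := dyadicBlock_lowBlock_mul_localize hφ q hp (LipschitzWith.const (1 : ℂ)) hg x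
  have h1 : ∀ y, lowBlock hφ (q - 2) (fun _ => (1 : ℂ)) y = 1 := fun y => by
    have := norm_sub_lowBlock_le hφ (LipschitzWith.const (1 : ℂ)) (q - 2) y
    simp only [NNReal.coe_zero, zero_mul, norm_le_zero_iff, sub_eq_zero] at this
    exact this.symm
  simp only [h1, one_mul] at h
  exact h.symm

end Dyadic

/-! ### The commutator estimate at a single frequency, for Lipschitz f. -/

section DyadicEstimate

variable {N : ℕ} {φ : 𝓢(EuclideanSpace ℝ (Fin N), ℝ)}

theorem ofReal_two_zpow (j : ℤ) : ENNReal.ofReal ((2 : ℝ) ^ j) = (2 : ℝ≥0∞) ^ (j : ℝ) := by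
  rw [← Real.rpow_intCast, ← ENNReal.ofReal_rpow_of_pos two_pos]
  simp

/-- f minus its low-pass part is expanded into the blocks Δ_{a+i} f by telescoping finitely many
steps; the remainder tends to 0 at each point x. -/
theorem enorm_dyadicBlock_mul_le_tsum (hφ : IsDyadicGenerator φ) (q : ℤ) {p : ℝ≥0∞} (hp : 1 ≤ p)
    {L : ℝ≥0} {f g : EuclideanSpace ℝ (Fin N) → ℂ} (hf : LipschitzWith L f)
    (hg : MemLp g p volume) (a : ℤ) (x : EuclideanSpace ℝ (Fin N)) :
    ‖dyadicBlock φ q (fun y => (f y - lowBlock hφ a f y) * g y) x‖ₑ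
      ≤ ∑' i : ℕ, ‖dyadicBlock φ q (fun y => dyadicBlock φ (a + i) f y * g y) x‖ₑ := by
  set κ := multiplierKernel (blockSchwartz hφ) q with hκ
  set M := ∫ y, ‖y‖ * ‖(𝓕⁻ (lowSchwartz hφ) : 𝓢(EuclideanSpace ℝ (Fin N), ℂ)) y‖
  have hlow : ∀ j, ∃ K, LipschitzWith K (lowBlock hφ j f) := fun j =>
    ⟨_, lipschitzWith_schwartzConv _ hf⟩
  have hsub : ∀ j, Integrable (fun y => κ (x - y) * ((f y - lowBlock hφ j f y) * g y)) volume :=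
    fun j => by
      obtain ⟨K, hK⟩ := hlow j
      refine ((integrable_schwartz_mul_lipschitz_mul κ hp hf hg x).sub
        (integrable_schwartz_mul_lipschitz_mul κ hp hK hg x)).congr
        (Filter.Eventually.of_forall fun y => ?_)
      simp only [Pi.sub_apply]
      ring
  have hblock : ∀ j, Integrable (fun y => κ (x - y) * (dyadicBlock φ j f y * g y)) volume :=
    fun j => by
      rw [dyadicBlock_eq hφ]
      exact integrable_schwartz_mul_lipschitz_mul κ hp (lipschitzWith_schwartzConv _ hf) hg x
  have hsplit : ∀ n : ℕ, dyadicBlock φ q (fun y => (f y - lowBlock hφ a f y) * g y) x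
      = ∑ i ∈ Finset.range n, dyadicBlock φ q (fun y => dyadicBlock φ (a + i) f y * g y) x
        + dyadicBlock φ q (fun y => (f y - lowBlock hφ (a + n) f y) * g y) x := fun n => by
    simp only [dyadicBlock_eq hφ q, ← hκ, schwartzConv]
    rw [← integral_finsetSum _ fun i _ => hblock _, ← integral_add
      (integrable_finsetSum _ fun i _ => hblock _) (hsub _)]
    refine integral_congr_ae (Filter.Eventually.of_forall fun y => ?_)
    simp only [lowBlock_add_sum hφ hf a n y, ← Finset.mul_sum, ← Finset.sum_mul]
    ring
  -- The Lipschitz bound makes f - S_{a+n} f of size 2^{-n} uniformly, while κ(x - ·) g is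
  -- integrable.
  have hrem : Filter.Tendsto
      (fun n : ℕ => dyadicBlock φ q (fun y => (f y - lowBlock hφ (a + n) f y) * g y) x)
      Filter.atTop (nhds 0) := by
    have hbound : ∀ n : ℕ, ‖dyadicBlock φ q (fun y => (f y - lowBlock hφ (a + n) f y) * g y) x‖
        ≤ (L * M * (2 : ℝ) ^ (-a) * ∫ y, ‖κ (x - y) * g y‖) * (1 / 2) ^ n := fun n => by
      rw [dyadicBlock_eq hφ q, ← hκ, schwartzConv, mul_right_comm, ← integral_const_mul]
      refine norm_integral_le_of_norm_le
        ((integrable_schwartz_mul_memLp κ hp hg x).norm.const_mul _)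
        (Filter.Eventually.of_forall fun y => ?_)
      have h := norm_sub_lowBlock_le hφ hf (a + n) y
      rw [neg_add, zpow_add₀ two_ne_zero, zpow_neg _ (n : ℤ), zpow_natCast] at h
      calc ‖κ (x - y) * ((f y - lowBlock hφ (a + n) f y) * g y)‖
          = ‖f y - lowBlock hφ (a + n) f y‖ * ‖κ (x - y) * g y‖ := by
            simp only [norm_mul]; ring
        _ ≤ (L * ((2 : ℝ) ^ (-a) * ((2 : ℝ) ^ n)⁻¹ * M)) * ‖κ (x - y) * g y‖ :=
            mul_le_mul_of_nonneg_right h (norm_nonneg _)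
        _ = _ := by rw [one_div, inv_pow]; ring
    refine squeeze_zero_norm hbound ?_
    simpa using (tendsto_pow_atTop_nhds_zero_of_lt_one (by norm_num : (0 : ℝ) ≤ 1 / 2)
      (by norm_num)).const_mul (L * M * (2 : ℝ) ^ (-a) * ∫ y, ‖κ (x - y) * g y‖)
  have hlim : Filter.Tendsto (fun n : ℕ => ‖dyadicBlock φ q
      (fun y => (f y - lowBlock hφ a f y) * g y) x
      - dyadicBlock φ q (fun y => (f y - lowBlock hφ (a + n) f y) * g y) x‖ₑ) Filter.atTop
      (nhds ‖dyadicBlock φ q (fun y => (f y - lowBlock hφ a f y) * g y) x‖ₑ) := by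
    have := (hrem.const_sub
      (dyadicBlock φ q (fun y => (f y - lowBlock hφ a f y) * g y) x)).enorm
    rwa [sub_zero] at this
  refine le_of_tendsto' hlim fun n => ?_
  rw [hsplit n, add_sub_cancel_right]
  exact (enorm_sum_le _ _).trans (ENNReal.sum_le_tsum _)

theorem aestronglyMeasurable_dyadicBlock (hφ : IsDyadicGenerator φ) (q : ℤ)
    {u : EuclideanSpace ℝ (Fin N) → ℂ} (hu : AEStronglyMeasurable u volume) :
    AEStronglyMeasurable (dyadicBlock φ q u) volume := by
  rw [dyadicBlock_eq hφ]
  exact aestronglyMeasurable_schwartzConv _ hu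

theorem eLpNorm_dyadicBlock_le (hφ : IsDyadicGenerator φ) (q : ℤ) {p : ℝ≥0∞} (hp : 1 ≤ p)
    {u : EuclideanSpace ℝ (Fin N) → ℂ} (hu : AEStronglyMeasurable u volume) :
    eLpNorm (dyadicBlock φ q u) p volume
      ≤ ENNReal.ofReal (∫ y, ‖(𝓕⁻ (blockSchwartz hφ) : 𝓢(EuclideanSpace ℝ (Fin N), ℂ)) y‖)
        * eLpNorm u p volume := by
  rw [dyadicBlock_eq hφ, ← integral_norm_multiplierKernel _ q]
  exact eLpNorm_schwartzConv_le _ hp hu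

theorem eLpNorm_mul_le_of_norm_le {c : ℝ} {F u : EuclideanSpace ℝ (Fin N) → ℂ}
    (hF : ∀ x, ‖F x‖ ≤ c) (p : ℝ≥0∞) :
    eLpNorm (fun x => F x * u x) p volume ≤ ENNReal.ofReal c * eLpNorm u p volume :=
  eLpNorm_le_mul_eLpNorm_of_ae_le_mul (Filter.Eventually.of_forall fun x => by
    rw [norm_mul]
    exact mul_le_mul_of_nonneg_right (hF x) (norm_nonneg _)) p

/-- Localization allows g to be replaced by its widened block in both halves of the low-frequency
commutator, which therefore stays a commutator. -/
theorem dyadicCommutator_eq_add_sub (hφ : IsDyadicGenerator φ) (q : ℤ) {p : ℝ≥0∞} (hp : 1 ≤ p)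
    {L : ℝ≥0} {f g : EuclideanSpace ℝ (Fin N) → ℂ} (hf : LipschitzWith L f)
    (hg : MemLp g p volume) (x : EuclideanSpace ℝ (Fin N)) :
    dyadicCommutator φ q f g x
      = (lowBlock hφ (q - 2) f x * dyadicBlock φ q (wideBlock hφ q g) x
          - dyadicBlock φ q (fun y => lowBlock hφ (q - 2) f y * wideBlock hφ q g y) x)
        + (f x - lowBlock hφ (q - 2) f x) * dyadicBlock φ q g x
        - dyadicBlock φ q (fun y => (f y - lowBlock hφ (q - 2) f y) * g y) x := by
  have h1 : dyadicBlock φ q (fun y => (f y - lowBlock hφ (q - 2) f y) * g y) x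
      = dyadicBlock φ q (fun y => f y * g y) x
        - dyadicBlock φ q (fun y => lowBlock hφ (q - 2) f y * g y) x := by
    have hlow : LipschitzWith _ (lowBlock hφ (q - 2) f) := lipschitzWith_schwartzConv _ hf
    rw [dyadicBlock_eq hφ, dyadicBlock_eq hφ, dyadicBlock_eq hφ, schwartzConv, schwartzConv,
      schwartzConv, ← integral_sub (integrable_schwartz_mul_lipschitz_mul _ hp hf hg x)
        (integrable_schwartz_mul_lipschitz_mul _ hp hlow hg x)]
    refine integral_congr_ae (Filter.Eventually.of_forall fun y => ?_)
    simp only [sub_mul, mul_sub]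
  rw [dyadicCommutator, h1, ← dyadicBlock_lowBlock_mul_localize hφ q hp hf hg x,
    dyadicBlock_wideBlock hφ q hp hg x]
  ring

/-- The tail of dyadic blocks of `g` that enters the commutator estimate at frequency `2^q`. -/
def highTail (φ : 𝓢(EuclideanSpace ℝ (Fin N), ℝ)) (p : ℝ≥0∞) (g : EuclideanSpace ℝ (Fin N) → ℂ)
    (j : ℤ) : ℝ≥0∞ :=
  (2 : ℝ≥0∞) ^ (-(j : ℝ)) *
    ∑ k ∈ Finset.Icc (-2 : ℤ) 2, eLpNorm (dyadicBlock φ (j + k) g) p volume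

/-- The `L^1` norm of the kernel of `Δ̇_0`. -/
def blockMass (hφ : IsDyadicGenerator φ) : ℝ≥0 :=
  Real.toNNReal (∫ y, ‖(𝓕⁻ (blockSchwartz hφ) : 𝓢(EuclideanSpace ℝ (Fin N), ℂ)) y‖)

/-- The first absolute moment of the kernel of `Δ̇_0`. -/
def blockMoment (hφ : IsDyadicGenerator φ) : ℝ≥0 :=
  Real.toNNReal (∫ y, ‖y‖ * ‖(𝓕⁻ (blockSchwartz hφ) : 𝓢(EuclideanSpace ℝ (Fin N), ℂ)) y‖)

/-- The `L^1` norm of the kernel of the low-pass filter. -/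
def lowMass (hφ : IsDyadicGenerator φ) : ℝ≥0 :=
  Real.toNNReal (∫ y, ‖(𝓕⁻ (lowSchwartz hφ) : 𝓢(EuclideanSpace ℝ (Fin N), ℂ)) y‖)

/-- The first absolute moment of the kernel of the low-pass filter. -/
def lowMoment (hφ : IsDyadicGenerator φ) : ℝ≥0 :=
  Real.toNNReal (∫ y, ‖y‖ * ‖(𝓕⁻ (lowSchwartz hφ) : 𝓢(EuclideanSpace ℝ (Fin N), ℂ)) y‖)

theorem two_zpow_mul_eLpNorm_wideBlock_le (hφ : IsDyadicGenerator φ) {p p₁ : ℝ≥0∞} (hp : 1 ≤ p)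
    (hp₁ : 1 ≤ p₁) {g : EuclideanSpace ℝ (Fin N) → ℂ} (hg : MemLp g p₁ volume) (j : ℤ) :
    ENNReal.ofReal ((2 : ℝ) ^ (-j)) * eLpNorm (wideBlock hφ j g) p volume ≤ highTail φ p g j := by
  rw [ofReal_two_zpow, highTail, Int.cast_neg]
  exact mul_le_mul_right (eLpNorm_wideBlock_le hφ j hp hp₁ hg) _

theorem two_zpow_mul_eLpNorm_dyadicBlock_le (p : ℝ≥0∞) (g : EuclideanSpace ℝ (Fin N) → ℂ) (j : ℤ) :
    ENNReal.ofReal ((2 : ℝ) ^ (-j)) * eLpNorm (dyadicBlock φ j g) p volume ≤ highTail φ p g j := by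
  rw [ofReal_two_zpow, highTail, Int.cast_neg]
  refine mul_le_mul_right ?_ _
  have := Finset.single_le_sum (f := fun k => eLpNorm (dyadicBlock φ (j + k) g) p volume)
    (fun _ _ => zero_le) (show (0 : ℤ) ∈ Finset.Icc (-2 : ℤ) 2 by simp)
  simpa using this

theorem eLpNorm_low_commutator_le (hφ : IsDyadicGenerator φ) (q : ℤ) {p p₁ : ℝ≥0∞}
    (hp : 1 ≤ p) (hp₁ : 1 ≤ p₁) {L : ℝ≥0} {f g : EuclideanSpace ℝ (Fin N) → ℂ}
    (hf : LipschitzWith L f) (hg : MemLp g p₁ volume) :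
    eLpNorm (fun x => lowBlock hφ (q - 2) f x * dyadicBlock φ q (wideBlock hφ q g) x
      - dyadicBlock φ q (fun y => lowBlock hφ (q - 2) f y * wideBlock hφ q g y) x) p volume
      ≤ (lowMass hφ * blockMoment hφ) * (L * highTail φ p g q) := by
  have h := eLpNorm_commutator_schwartzConv_le (multiplierKernel (blockSchwartz hφ) q) hp hp₁
    (lipschitzWith_schwartzConv (multiplierKernel (lowSchwartz hφ) (q - 2)) hf)
    (memLp_schwartzConv (𝓕⁻ (wideSymbol hφ q)) hp₁ hg)
  rw [integral_norm_multiplierKernel, integral_norm_mul_norm_multiplierKernel,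
    ENNReal.ofReal_mul (by positivity), ENNReal.coe_mul] at h
  simp only [dyadicBlock_eq hφ q]
  refine h.trans ?_
  change (lowMass hφ * L : ℝ≥0∞) * (ENNReal.ofReal ((2 : ℝ) ^ (-q)) * blockMoment hφ
    * eLpNorm (wideBlock hφ q g) p volume) ≤ _
  calc (lowMass hφ * L : ℝ≥0∞) * (ENNReal.ofReal ((2 : ℝ) ^ (-q)) * blockMoment hφ
        * eLpNorm (wideBlock hφ q g) p volume)
      = (lowMass hφ * blockMoment hφ) * (L * (ENNReal.ofReal ((2 : ℝ) ^ (-q))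
        * eLpNorm (wideBlock hφ q g) p volume)) := by ring
    _ ≤ _ := mul_le_mul_right
        (mul_le_mul_right (two_zpow_mul_eLpNorm_wideBlock_le hφ hp hp₁ hg q) _) _

theorem eLpNorm_high_mul_dyadicBlock_le (hφ : IsDyadicGenerator φ) (q : ℤ) (p : ℝ≥0∞) {L : ℝ≥0}
    {f : EuclideanSpace ℝ (Fin N) → ℂ} (hf : LipschitzWith L f)
    (g : EuclideanSpace ℝ (Fin N) → ℂ) :
    eLpNorm (fun x => (f x - lowBlock hφ (q - 2) f x) * dyadicBlock φ q g x) p volume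
      ≤ (4 * lowMoment hφ) * (L * highTail φ p g q) := by
  refine (eLpNorm_mul_le_of_norm_le (fun x => norm_sub_lowBlock_le hφ hf (q - 2) x) p).trans ?_
  rw [ENNReal.ofReal_mul L.coe_nonneg, ENNReal.ofReal_coe_nnreal,
    ENNReal.ofReal_mul (by positivity), show -(q - 2) = -q + 2 by ring,
    zpow_add₀ two_ne_zero, ENNReal.ofReal_mul (by positivity),
    show (2 : ℝ) ^ (2 : ℤ) = 4 by norm_num, ENNReal.ofReal_ofNat]
  change (L : ℝ≥0∞) * (ENNReal.ofReal ((2 : ℝ) ^ (-q)) * 4 * lowMoment hφ)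
    * eLpNorm (dyadicBlock φ q g) p volume ≤ _
  calc (L : ℝ≥0∞) * (ENNReal.ofReal ((2 : ℝ) ^ (-q)) * 4 * lowMoment hφ)
        * eLpNorm (dyadicBlock φ q g) p volume
      = (4 * lowMoment hφ) * (L * (ENNReal.ofReal ((2 : ℝ) ^ (-q))
        * eLpNorm (dyadicBlock φ q g) p volume)) := by ring
    _ ≤ _ := mul_le_mul_right
        (mul_le_mul_right (two_zpow_mul_eLpNorm_dyadicBlock_le p g q) _) _

theorem eLpNorm_dyadicBlock_dyadicBlock_mul_le (hφ : IsDyadicGenerator φ) (q j : ℤ)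
    {p p₁ p₂ : ℝ≥0∞} (hp : 1 ≤ p) (hpp : p⁻¹ = p₁⁻¹ + p₂⁻¹) {f g : EuclideanSpace ℝ (Fin N) → ℂ}
    (hf : AEStronglyMeasurable f volume) (hg : AEStronglyMeasurable g volume) :
    eLpNorm (dyadicBlock φ q fun y => dyadicBlock φ j f y * g y) p volume
      ≤ blockMass hφ * (eLpNorm g p₁ volume * eLpNorm (dyadicBlock φ j f) p₂ volume) := by
  have : ENNReal.HolderTriple p₂ p₁ p := ⟨by rw [hpp, add_comm]⟩
  have hm := aestronglyMeasurable_dyadicBlock hφ j hf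
  generalize dyadicBlock φ j f = F at hm ⊢
  have h := eLpNorm_smul_le_mul_eLpNorm (p := p₂) (q := p₁) (r := p) hg hm
  rw [mul_comm (eLpNorm F p₂ volume)] at h
  exact (eLpNorm_dyadicBlock_le hφ q hp (hm.mul hg)).trans (mul_le_mul_right h _)

theorem eLpNorm_dyadicBlock_dyadicBlock_mul_le_of_le (hφ : IsDyadicGenerator φ) {q j : ℤ}
    (hqj : q + 3 ≤ j) {p p₁ : ℝ≥0∞} (hp : 1 ≤ p) (hp₁ : 1 ≤ p₁) {L : ℝ≥0}
    {f g : EuclideanSpace ℝ (Fin N) → ℂ} (hf : LipschitzWith L f) (hg : MemLp g p₁ volume) :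
    eLpNorm (dyadicBlock φ q fun y => dyadicBlock φ j f y * g y) p volume
      ≤ (blockMass hφ * blockMoment hφ) * (L * highTail φ p g j) := by
  have h1 : (dyadicBlock φ q fun y => dyadicBlock φ j f y * g y)
      = dyadicBlock φ q (fun y => dyadicBlock φ j f y * wideBlock hφ j g y) :=
    funext fun x => dyadicBlock_dyadicBlock_mul_localize hφ hqj hp₁ hf hg x
  rw [h1]
  refine (eLpNorm_dyadicBlock_le hφ q hp
    ((aestronglyMeasurable_dyadicBlock hφ _ hf.continuous.aestronglyMeasurable).mul
      (aestronglyMeasurable_schwartzConv _ hg.1))).trans ?_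
  rw [mul_assoc]
  refine mul_le_mul_right ?_ _
  refine (eLpNorm_mul_le_of_norm_le (norm_dyadicBlock_lipschitz_le hφ hf j) p).trans ?_
  rw [ENNReal.ofReal_mul L.coe_nonneg, ENNReal.ofReal_coe_nnreal,
    ENNReal.ofReal_mul (by positivity)]
  change (L : ℝ≥0∞) * (ENNReal.ofReal ((2 : ℝ) ^ (-j)) * blockMoment hφ)
    * eLpNorm (wideBlock hφ j g) p volume ≤ _
  calc (L : ℝ≥0∞) * (ENNReal.ofReal ((2 : ℝ) ^ (-j)) * blockMoment hφ)
        * eLpNorm (wideBlock hφ j g) p volume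
      = blockMoment hφ * (L * (ENNReal.ofReal ((2 : ℝ) ^ (-j))
        * eLpNorm (wideBlock hφ j g) p volume)) := by ring
    _ ≤ _ := mul_le_mul_right
        (mul_le_mul_right (two_zpow_mul_eLpNorm_wideBlock_le hφ hp hp₁ hg j) _) _

/-- Blocks of f near frequency 2^q are paired with g by Hölder. Those far above force g to the same
high frequency and use the Lipschitz bound on f. -/
theorem eLpNorm_dyadicBlock_high_mul_le (hφ : IsDyadicGenerator φ) (q : ℤ) {p p₁ p₂ : ℝ≥0∞}
    (hp : 1 ≤ p) (hp₁ : 1 ≤ p₁) (hpp : p⁻¹ = p₁⁻¹ + p₂⁻¹) {L : ℝ≥0}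
    {f g : EuclideanSpace ℝ (Fin N) → ℂ} (hf : LipschitzWith L f) (hg : MemLp g p₁ volume) :
    eLpNorm (dyadicBlock φ q (fun y => (f y - lowBlock hφ (q - 2) f y) * g y)) p volume
      ≤ blockMass hφ * (eLpNorm g p₁ volume *
          ∑ k ∈ Finset.Icc (-2 : ℤ) 2, eLpNorm (dyadicBlock φ (q + k) f) p₂ volume)
        + (blockMass hφ * blockMoment hφ) * (L * ∑' n : ℕ, highTail φ p g (q + n)) := by
  have hfm := hf.continuous.aestronglyMeasurable (μ := (volume : Measure (EuclideanSpace ℝ (Fin N))))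
  set F : ℕ → EuclideanSpace ℝ (Fin N) → ℂ := fun i =>
    dyadicBlock φ q (fun y => dyadicBlock φ (q - 2 + i) f y * g y) with hF
  have hFm : ∀ i, AEStronglyMeasurable (F i) volume := fun i =>
    aestronglyMeasurable_dyadicBlock hφ q ((aestronglyMeasurable_dyadicBlock hφ _ hfm).mul hg.1)
  have hnear : ∀ i : ℕ, eLpNorm (F i) p volume ≤ blockMass hφ *
      (eLpNorm g p₁ volume * eLpNorm (dyadicBlock φ (q - 2 + i) f) p₂ volume) := fun i =>
    eLpNorm_dyadicBlock_dyadicBlock_mul_le hφ q _ hp hpp hfm hg.1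
  have hfar : ∀ i : ℕ, eLpNorm (F (i + 5)) p volume
      ≤ (blockMass hφ * blockMoment hφ) * (L * highTail φ p g (q + (i + 3 : ℕ))) := fun i => by
    -- The sum starts at j = q-2, so the first five terms are |j-q| ≤ 2 and the sixth is j = q+3,
    -- the first index to which high-frequency localization applies.
    have hj : q - 2 + ((i + 5 : ℕ) : ℤ) = q + ((i + 3 : ℕ) : ℤ) := by push_cast; ring
    simp only [hF, hj]
    exact eLpNorm_dyadicBlock_dyadicBlock_mul_le_of_le hφ (by push_cast; omega) hp hp₁ hf hg
  calc eLpNorm (dyadicBlock φ q (fun y => (f y - lowBlock hφ (q - 2) f y) * g y)) p volume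
      ≤ eLpNorm (fun x => ∑' i, ‖F i x‖ₑ) p volume :=
        eLpNorm_mono_enorm fun x => by
          simpa using enorm_dyadicBlock_mul_le_tsum hφ q hp₁ hf hg (q - 2) x
    _ ≤ ∑' i, eLpNorm (fun x => ‖F i x‖ₑ) p volume :=
        eLpNorm_tsum_le_tsum_eLpNorm hp fun i => (hFm i).enorm
    _ = ∑ i ∈ Finset.range 5, eLpNorm (F i) p volume
        + ∑' i, eLpNorm (F (i + 5)) p volume := by
        simp only [eLpNorm_enorm]
        rw [ENNReal.summable.sum_add_tsum_nat_add']
    _ ≤ _ := by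
        refine add_le_add ?_ ?_
        · refine (Finset.sum_le_sum fun i _ => hnear i).trans (le_of_eq ?_)
          rw [← Finset.mul_sum, ← Finset.mul_sum]
          congr 2
          refine Finset.sum_nbij' (fun i : ℕ => (i : ℤ) - 2) (fun k => (k + 2).toNat)
            ?_ ?_ ?_ ?_ ?_
          · intro i hi
            simp only [Finset.mem_range, Finset.mem_Icc] at hi ⊢
            omega
          · intro k hk
            simp only [Finset.mem_range, Finset.mem_Icc] at hk ⊢
            omega
          · intro i hi
            simp
          · intro k hk
            simp only [Finset.mem_Icc] at hk
            omega
          · intro i hi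
            rw [show q - 2 + (i : ℤ) = q + (i - 2) by ring]
        · refine (ENNReal.tsum_le_tsum hfar).trans ?_
          rw [ENNReal.tsum_mul_left, ENNReal.tsum_mul_left]
          refine mul_le_mul_right (mul_le_mul_right ?_ _) _
          exact ENNReal.tsum_comp_le_tsum_of_injective (add_left_injective 3)
            (fun n : ℕ => highTail φ p g (q + n))

theorem holder_one_le_left {p p₁ p₂ : ℝ≥0∞} (hp : 1 ≤ p) (h : p⁻¹ = p₁⁻¹ + p₂⁻¹) : 1 ≤ p₁ := by
  rw [← ENNReal.inv_le_inv, inv_one]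
  exact (le_self_add.trans h.ge).trans (ENNReal.inv_le_one.2 hp)

/-- The commutator estimate before summation over the frequencies. -/
theorem exists_eLpNorm_dyadicCommutator_le (hφ : IsDyadicGenerator φ) :
    ∃ C : ℝ≥0, ∀ {p p₁ p₂ : ℝ≥0∞}, 1 ≤ p → p⁻¹ = p₁⁻¹ + p₂⁻¹ → ∀ {L : ℝ≥0}
      {f g : EuclideanSpace ℝ (Fin N) → ℂ}, LipschitzWith L f → MemLp g p₁ volume → ∀ q : ℤ,
      eLpNorm (dyadicCommutator φ q f g) p volume ≤ C *
        (L * ∑' n : ℕ, highTail φ p g (q + n) + eLpNorm g p₁ volume *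
          ∑ k ∈ Finset.Icc (-2 : ℤ) 2, eLpNorm (dyadicBlock φ (q + k) f) p₂ volume) := by
  refine ⟨lowMass hφ * blockMoment hφ + 4 * lowMoment hφ + blockMass hφ
    + blockMass hφ * blockMoment hφ, ?_⟩
  intro p p₁ p₂ hp hpp L f g hf hg q
  have hp₁ : 1 ≤ p₁ := holder_one_le_left hp hpp
  have hfm := hf.continuous.aestronglyMeasurable (μ := (volume : Measure (EuclideanSpace ℝ (Fin N))))
  have hlowm : AEStronglyMeasurable (lowBlock hφ (q - 2) f) volume :=
    aestronglyMeasurable_schwartzConv _ hfm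
  have hGm : AEStronglyMeasurable (wideBlock hφ q g) volume :=
    aestronglyMeasurable_schwartzConv _ hg.1
  have hT1 : AEStronglyMeasurable (fun x =>
      lowBlock hφ (q - 2) f x * dyadicBlock φ q (wideBlock hφ q g) x
      - dyadicBlock φ q (fun y => lowBlock hφ (q - 2) f y * wideBlock hφ q g y) x) volume :=
    (hlowm.mul (aestronglyMeasurable_dyadicBlock hφ q hGm)).sub
      (aestronglyMeasurable_dyadicBlock hφ q (hlowm.mul hGm))
  have hT2 : AEStronglyMeasurable
      (fun x => (f x - lowBlock hφ (q - 2) f x) * dyadicBlock φ q g x) volume :=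
    (hfm.sub hlowm).mul (aestronglyMeasurable_dyadicBlock hφ q hg.1)
  have hT3 : AEStronglyMeasurable
      (dyadicBlock φ q (fun y => (f y - lowBlock hφ (q - 2) f y) * g y)) volume :=
    aestronglyMeasurable_dyadicBlock hφ q ((hfm.sub hlowm).mul hg.1)
  have heq : dyadicCommutator φ q f g = ((fun x =>
      lowBlock hφ (q - 2) f x * dyadicBlock φ q (wideBlock hφ q g) x
      - dyadicBlock φ q (fun y => lowBlock hφ (q - 2) f y * wideBlock hφ q g y) x)
      + fun x => (f x - lowBlock hφ (q - 2) f x) * dyadicBlock φ q g x)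
      - dyadicBlock φ q (fun y => (f y - lowBlock hφ (q - 2) f y) * g y) :=
    funext fun x => dyadicCommutator_eq_add_sub hφ q hp₁ hf hg x
  rw [heq]
  refine ((eLpNorm_sub_le (hT1.add hT2) hT3 hp).trans (add_le_add
    ((eLpNorm_add_le hT1 hT2 hp).trans (add_le_add
      (eLpNorm_low_commutator_le hφ q hp hp₁ hf hg)
      (eLpNorm_high_mul_dyadicBlock_le hφ q p hf g)))
    (eLpNorm_dyadicBlock_high_mul_le hφ q hp hp₁ hpp hf hg))).trans ?_
  -- The terms at frequency exactly q are absorbed into the tail as its entry n = 0.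
  have hwq : highTail φ p g q ≤ ∑' n : ℕ, highTail φ p g (q + n) := by
    simpa using ENNReal.le_tsum (f := fun n : ℕ => highTail φ p g (q + n)) 0
  generalize highTail φ p g q = w at hwq ⊢
  generalize ∑' n : ℕ, highTail φ p g (q + n) = W at hwq ⊢
  generalize eLpNorm g p₁ volume *
    ∑ k ∈ Finset.Icc (-2 : ℤ) 2, eLpNorm (dyadicBlock φ (q + k) f) p₂ volume = S
  have h1 : L * w ≤ L * W + S := (mul_le_mul_right hwq _).trans le_self_add
  have h2 : L * W ≤ L * W + S := le_self_add
  have h3 : S ≤ L * W + S := le_add_self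
  generalize L * w = X at h1
  generalize hY : L * W + S = Y at h1 h2 h3 ⊢
  push_cast
  calc _ ≤ lowMass hφ * blockMoment hφ * Y + 4 * lowMoment hφ * Y
        + (blockMass hφ * Y + blockMass hφ * blockMoment hφ * Y) :=
        add_le_add (add_le_add (mul_le_mul_right h1 _) (mul_le_mul_right h1 _))
          (add_le_add (mul_le_mul_right h3 _) (mul_le_mul_right h2 _))
    _ = _ := by ring

end DyadicEstimate

/-! ### Bounded weak gradient implies a Lipschitz representative. -/

section WeakGradient

variable {N : ℕ}

/-- Testing the weak gradient against ρ(x - ·) moves the derivative from ρ to f, leaving an average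
of a component of `F`. -/
theorem HasWeakGradient.norm_partial_mollify_le {f : EuclideanSpace ℝ (Fin N) → ℂ}
    {F : EuclideanSpace ℝ (Fin N) → EuclideanSpace ℂ (Fin N)} (h : HasWeakGradient f F) {M : ℝ}
    (hM : ∀ᵐ x, ‖F x‖ ≤ M) {ρ : EuclideanSpace ℝ (Fin N) → ℝ} (hρ : ContDiff ℝ (⊤ : ℕ∞) ρ)
    (hc : HasCompactSupport ρ) (h0 : ∀ x, 0 ≤ ρ x) (h1 : ∫ x, ρ x = 1)
    (x : EuclideanSpace ℝ (Fin N)) (i : Fin N) :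
    ‖∫ y, fderiv ℝ ρ (x - y) (EuclideanSpace.single i 1) • f y‖ ≤ M := by
  have hψ := h.integral_eq (fun y => ρ (x - y)) (hρ.comp (contDiff_const.sub contDiff_id))
    (hc.comp_homeomorph (Homeomorph.subLeft x)) i
  have hd : ∀ y, fderiv ℝ (fun y => ρ (x - y)) y = -fderiv ℝ ρ (x - y) := fun y => by
    have hdiff : DifferentiableAt ℝ ρ (x - y) := (hρ.differentiable (by simp)) _
    have := (hdiff.hasFDerivAt.comp y ((hasFDerivAt_id y).const_sub x)).fderiv
    simpa [Function.comp_def] using this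
  simp only [hd, neg_apply, neg_smul, integral_neg, neg_inj] at hψ
  rw [hψ]
  calc ‖∫ y, ρ (x - y) • F y i‖ ≤ ∫ y, ρ (x - y) * M := by
        refine norm_integral_le_of_norm_le ?_ ?_
        · exact ((hρ.continuous.integrable_of_hasCompactSupport hc).comp_sub_left x).mul_const _
        · filter_upwards [hM] with y hy
          rw [norm_smul, Real.norm_of_nonneg (h0 _)]
          exact mul_le_mul_of_nonneg_left ((PiLp.norm_apply_le (F y) i).trans hy) (h0 _)
    _ = M := by rw [integral_mul_const, integral_sub_left_eq_self _ volume x, h1, one_mul]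

theorem HasWeakGradient.lipschitzWith_mollify {f : EuclideanSpace ℝ (Fin N) → ℂ}
    {F : EuclideanSpace ℝ (Fin N) → EuclideanSpace ℂ (Fin N)} (h : HasWeakGradient f F) {M : ℝ≥0}
    (hM : ∀ᵐ x, ‖F x‖ ≤ M) {ρ : EuclideanSpace ℝ (Fin N) → ℝ} (hρ : ContDiff ℝ (⊤ : ℕ∞) ρ)
    (hc : HasCompactSupport ρ) (h0 : ∀ x, 0 ≤ ρ x) (h1 : ∫ x, ρ x = 1) :
    LipschitzWith (N * M) (ρ ⋆[ContinuousLinearMap.lsmul ℝ ℝ, volume] f) := by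
  have hder := hc.hasFDerivAt_convolution_left (ContinuousLinearMap.lsmul ℝ ℝ : ℝ →L[ℝ] ℂ →L[ℝ] ℂ)
    (hρ.of_le (by exact_mod_cast le_top)) h.locallyIntegrable
  refine lipschitzWith_of_nnnorm_fderiv_le (𝕜 := ℝ) (fun x => (hder x).differentiableAt)
    fun x => ?_
  rw [(hder x).fderiv]
  refine ContinuousLinearMap.opNorm_le_bound _ (NNReal.coe_nonneg _) fun v => ?_
  have hex : ConvolutionExistsAt (fderiv ℝ ρ) f x
      ((ContinuousLinearMap.lsmul ℝ ℝ : ℝ →L[ℝ] ℂ →L[ℝ] ℂ).precompL (EuclideanSpace ℝ (Fin N)))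
      volume :=
    (hc.fderiv ℝ).convolutionExists_left _ (hρ.continuous_fderiv (by simp)) h.locallyIntegrable x
  have happ : ∀ v, (fderiv ℝ ρ ⋆[(ContinuousLinearMap.lsmul ℝ ℝ : ℝ →L[ℝ] ℂ →L[ℝ] ℂ).precompL
      (EuclideanSpace ℝ (Fin N)), volume] f) x v = ∫ y, fderiv ℝ ρ (x - y) v • f y := fun v => by
    rw [convolution_def, ContinuousLinearMap.integral_apply hex,
      ← integral_sub_left_eq_self _ volume x]
    refine integral_congr_ae (Filter.Eventually.of_forall fun y => ?_)
    simp [ContinuousLinearMap.precompL_apply]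
  have hv : v = ∑ i, v i • EuclideanSpace.single i (1 : ℝ) := by
    conv_lhs => rw [← (EuclideanSpace.basisFun (Fin N) ℝ).sum_repr v]
    simp
  conv_lhs => rw [hv]
  rw [map_sum]
  refine (norm_sum_le _ _).trans ?_
  calc ∑ i, ‖(fderiv ℝ ρ ⋆[(ContinuousLinearMap.lsmul ℝ ℝ : ℝ →L[ℝ] ℂ →L[ℝ] ℂ).precompL
        (EuclideanSpace ℝ (Fin N)), volume] f) x (v i • EuclideanSpace.single i (1 : ℝ))‖
      ≤ ∑ _i : Fin N, ‖v‖ * M := by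
        refine Finset.sum_le_sum fun i _ => ?_
        rw [map_smul, norm_smul, happ]
        exact mul_le_mul (PiLp.norm_apply_le v i)
          (h.norm_partial_mollify_le hM hρ hc h0 h1 x i) (norm_nonneg _) (norm_nonneg _)
    _ = (N * M : ℝ≥0) * ‖v‖ := by
        rw [Finset.sum_const, Finset.card_univ, Fintype.card_fin, nsmul_eq_mul]
        push_cast
        ring

/-- A function with bounded weak gradient has a Lipschitz representative. -/
theorem HasWeakGradient.exists_lipschitzWith_ae_eq {f : EuclideanSpace ℝ (Fin N) → ℂ}
    {F : EuclideanSpace ℝ (Fin N) → EuclideanSpace ℂ (Fin N)} (h : HasWeakGradient f F) {M : ℝ≥0}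
    (hM : ∀ᵐ x, ‖F x‖ ≤ M) :
    ∃ f' : EuclideanSpace ℝ (Fin N) → ℂ,
      LipschitzWith (lipschitzExtensionConstant ℂ * (N * M)) f' ∧ f =ᵐ[volume] f' := by
  let ρ : ℕ → ContDiffBump (0 : EuclideanSpace ℝ (Fin N)) := fun n =>
    ⟨1 / (n + 1), 2 / (n + 1), by positivity, by gcongr; norm_num⟩
  have hout : Filter.Tendsto (fun n => (ρ n).rOut) Filter.atTop (nhds 0) := by
    have := (tendsto_one_div_add_atTop_nhds_zero_nat (𝕜 := ℝ)).const_mul 2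
    simpa [ρ, div_eq_mul_inv] using this
  have hae := ContDiffBump.ae_convolution_tendsto_right_of_locallyIntegrable (φ := ρ) (K := 2)
    hout (Filter.Eventually.of_forall fun n => by simp only [ρ]; apply le_of_eq; ring)
    h.locallyIntegrable
  have hLip : ∀ n, LipschitzWith (N * M) ((ρ n).normed volume
      ⋆[ContinuousLinearMap.lsmul ℝ ℝ, volume] f) := fun n =>
    h.lipschitzWith_mollify hM (ρ n).contDiff_normed (ρ n).hasCompactSupport_normed
      (fun x => (ρ n).nonneg_normed x) (ρ n).integral_normed
  -- The mollifications are Lipschitz with a common constant and converge to f almost everywhere, so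
  -- f is Lipschitz on the convergence set. It is then extended from that set to the whole space.
  have hOn : LipschitzOnWith (N * M) f {x | Filter.Tendsto (fun n => ((ρ n).normed volume
      ⋆[ContinuousLinearMap.lsmul ℝ ℝ, volume] f) x) Filter.atTop (nhds (f x))} := by
    intro x hx y hy
    exact le_of_tendsto' (Filter.Tendsto.edist hx hy) fun n => hLip n x y
  obtain ⟨f', hf', heq⟩ := hOn.extend_finite_dimension
  refine ⟨f', hf', ?_⟩
  filter_upwards [hae] with x hx using heq hx

end WeakGradient

/-! ### Passage to bounded weak gradients and to mixed space-time norms. -/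

section TimeEstimate

variable {N : ℕ} {φ : 𝓢(EuclideanSpace ℝ (Fin N), ℝ)}

theorem dyadicCommutator_ae_eq (hφ : IsDyadicGenerator φ) (q : ℤ)
    {f f' : EuclideanSpace ℝ (Fin N) → ℂ} (h : f =ᵐ[volume] f')
    (g : EuclideanSpace ℝ (Fin N) → ℂ) :
    dyadicCommutator φ q f g =ᵐ[volume] dyadicCommutator φ q f' g := by
  have h1 : dyadicBlock φ q (fun y => f y * g y) = dyadicBlock φ q (fun y => f' y * g y) := by
    rw [dyadicBlock_eq hφ, dyadicBlock_eq hφ]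
    exact schwartzConv_congr_ae _ (h.mono fun y hy => by simp only [hy])
  filter_upwards [h] with x hx
  rw [dyadicCommutator, dyadicCommutator, h1, hx]

/-- Replacing f by its Lipschitz representative leaves its blocks unchanged and alters the
commutator only on a null set. -/
theorem exists_eLpNorm_dyadicCommutator_le_of_hasWeakGradient (hφ : IsDyadicGenerator φ) :
    ∃ C : ℝ≥0, ∀ {p p₁ p₂ : ℝ≥0∞}, 1 ≤ p → p⁻¹ = p₁⁻¹ + p₂⁻¹ →
      ∀ {f g : EuclideanSpace ℝ (Fin N) → ℂ}
      {F : EuclideanSpace ℝ (Fin N) → EuclideanSpace ℂ (Fin N)}, HasWeakGradient f F →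
      eLpNorm F ∞ volume < ∞ → MemLp g p₁ volume → ∀ q : ℤ,
      eLpNorm (dyadicCommutator φ q f g) p volume ≤ C *
        (eLpNorm F ∞ volume * ∑' n : ℕ, highTail φ p g (q + n) + eLpNorm g p₁ volume *
          ∑ k ∈ Finset.Icc (-2 : ℤ) 2, eLpNorm (dyadicBlock φ (q + k) f) p₂ volume) := by
  obtain ⟨C, hC⟩ := exists_eLpNorm_dyadicCommutator_le hφ
  set K : ℝ≥0 := lipschitzExtensionConstant ℂ * N
  refine ⟨C * (K + 1), ?_⟩
  intro p p₁ p₂ hp hpp f g F hF hfin hg q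
  have hM : ∀ᵐ x, ‖F x‖ ≤ ((eLpNorm F ∞ volume).toNNReal : ℝ) := by
    have h := ae_le_eLpNormEssSup (f := F) (μ := volume)
    filter_upwards [h] with x hx
    rw [← eLpNorm_exponent_top, ← ENNReal.coe_toNNReal hfin.ne, enorm_le_coe] at hx
    exact_mod_cast hx
  obtain ⟨f', hf', heq⟩ := hF.exists_lipschitzWith_ae_eq hM
  have hblock : ∀ j, dyadicBlock φ j f = dyadicBlock φ j f' := fun j => by
    rw [dyadicBlock_eq hφ, dyadicBlock_eq hφ]
    exact schwartzConv_congr_ae _ heq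
  have h := hC hp hpp hf' hg q
  rw [← eLpNorm_congr_ae (dyadicCommutator_ae_eq hφ q heq g)] at h
  simp only [← hblock] at h
  have hK : ((lipschitzExtensionConstant ℂ * (N * (eLpNorm F ∞ volume).toNNReal) : ℝ≥0) : ℝ≥0∞)
      = K * eLpNorm F ∞ volume := by
    rw [← mul_assoc, ENNReal.coe_mul, ENNReal.coe_toNNReal hfin.ne]
  rw [hK] at h
  refine h.trans ?_
  rw [ENNReal.coe_mul C, mul_assoc (C : ℝ≥0∞)]
  refine mul_le_mul_right ?_ _
  rw [ENNReal.coe_add, ENNReal.coe_one]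
  generalize ∑' n : ℕ, highTail φ p g (q + n) = X
  generalize eLpNorm g p₁ volume *
    ∑ k ∈ Finset.Icc (-2 : ℤ) 2, eLpNorm (dyadicBlock φ (q + k) f) p₂ volume = S
  generalize eLpNorm F ∞ volume = M
  calc (K : ℝ≥0∞) * M * X + S ≤ (K * (M * X) + M * X) + (K * S + S) := by
        rw [mul_assoc]
        exact add_le_add le_self_add le_add_self
    _ = (K + 1) * (M * X + S) := by ring

theorem SpaceTimeMeasurable.aemeasurable_eLpNorm {T : ℝ} {V : Type*} [NormedAddCommGroup V]
    {u : ℝ → EuclideanSpace ℝ (Fin N) → V} (hu : SpaceTimeMeasurable T u) (p : ℝ≥0∞) :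
    AEMeasurable (fun t => eLpNorm (u t) p volume) (volume.restrict (Ioo 0 T)) := by
  obtain ⟨v, hv, huv⟩ := hu
  refine ⟨fun t => eLpNorm (fun x => v (t, x)) p volume,
    measurable_eLpNorm_prod_right (u := fun t x => v (t, x)) hv p, ?_⟩
  filter_upwards [Measure.ae_ae_of_ae_prod huv] with t ht
  exact eLpNorm_congr_ae ht

theorem SpaceTimeMeasurable.aemeasurable_eLpNorm_dyadicBlock (hφ : IsDyadicGenerator φ) {T : ℝ}
    {u : ℝ → EuclideanSpace ℝ (Fin N) → ℂ} (hu : SpaceTimeMeasurable T u) (q : ℤ) (p : ℝ≥0∞) :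
    AEMeasurable (fun t => eLpNorm (dyadicBlock φ q (u t)) p volume)
      (volume.restrict (Ioo 0 T)) := by
  obtain ⟨v, hv, huv⟩ := hu
  simp only [dyadicBlock_eq hφ]
  set κ := multiplierKernel (blockSchwartz hφ) q
  refine ⟨fun t => eLpNorm (schwartzConv κ fun x => v (t, x)) p volume,
    measurable_eLpNorm_prod_right (u := fun t => schwartzConv κ fun x => v (t, x)) ?_ p, ?_⟩
  · have hκ := κ.continuous
    refine StronglyMeasurable.integral_prod_right
      (f := fun (z : ℝ × EuclideanSpace ℝ (Fin N)) y => κ (z.2 - y) * v (z.1, y)) ?_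
    refine StronglyMeasurable.mul ?_ (hv.comp_measurable (by fun_prop))
    exact Continuous.stronglyMeasurable (by fun_prop)
  · filter_upwards [Measure.ae_ae_of_ae_prod huv] with t ht
    have ht' : u t =ᵐ[volume] fun x => v (t, x) := ht
    rw [schwartzConv_congr_ae κ ht']

theorem ae_lt_top_of_eLpNorm_lt_top {α : Type*} [MeasurableSpace α] {μ : Measure α} {p : ℝ≥0∞}
    (hp : 1 ≤ p) {f : α → ℝ≥0∞} (hf : AEMeasurable f μ) (h : eLpNorm f p μ < ∞) :
    ∀ᵐ x ∂μ, f x < ∞ := by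
  by_cases hpt : p = ∞
  · subst hpt
    filter_upwards [ae_le_eLpNormEssSup (f := f) (μ := μ)] with x hx
    exact lt_of_le_of_lt hx h
  have hp0 : p ≠ 0 := (zero_lt_one.trans_le hp).ne'
  have hpr : 0 < p.toReal := ENNReal.toReal_pos hp0 hpt
  have h1 := lintegral_rpow_enorm_lt_top_of_eLpNorm_lt_top hp0 hpt h
  simp only [enorm_eq_self] at h1
  filter_upwards [ae_lt_top' (hf.pow_const _) h1.ne] with x hx
  exact (ENNReal.rpow_lt_top_iff_of_pos hpr).1 hx

/-- The spatial estimate holds at almost every time with a constant independent of t; its L^θ norm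
is taken term by term, with Hölder in time on each product. -/
theorem exists_mixedNorm_dyadicCommutator_le (hφ : IsDyadicGenerator φ) :
    ∃ C : ℝ≥0, ∀ {p p₁ p₂ : ℝ≥0∞}, 1 ≤ p → p⁻¹ = p₁⁻¹ + p₂⁻¹ →
      ∀ {θ θ₁ θ₂ θ₃ θ₄ : ℝ≥0∞}, 1 ≤ θ → θ⁻¹ = θ₁⁻¹ + θ₂⁻¹ → θ⁻¹ = θ₃⁻¹ + θ₄⁻¹ → ∀ {T : ℝ}
      {f g : ℝ → EuclideanSpace ℝ (Fin N) → ℂ}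
      {F : ℝ → EuclideanSpace ℝ (Fin N) → EuclideanSpace ℂ (Fin N)},
      SpaceTimeMeasurable T f → SpaceTimeMeasurable T g → SpaceTimeMeasurable T F →
      (∀ᵐ t ∂(volume.restrict (Ioo 0 T)), HasWeakGradient (f t) (F t)) →
      mixedNorm T θ₁ ∞ F < ∞ → (∀ j, mixedNorm T θ₄ p₂ (fun t => dyadicBlock φ j (f t)) < ∞) →
      mixedNorm T θ₃ p₁ g < ∞ → (∀ j, mixedNorm T θ₂ p (fun t => dyadicBlock φ j (g t)) < ∞) →
      ∀ q : ℤ, mixedNorm T θ p (fun t => dyadicCommutator φ q (f t) (g t)) ≤ C *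
        (mixedNorm T θ₁ ∞ F * ∑' n : ℕ, (2 : ℝ≥0∞) ^ (-((q + n : ℤ) : ℝ)) *
            ∑ k ∈ Finset.Icc (-2 : ℤ) 2, mixedNorm T θ₂ p (fun t => dyadicBlock φ (q + n + k) (g t))
          + mixedNorm T θ₃ p₁ g *
            ∑ k ∈ Finset.Icc (-2 : ℤ) 2,
              mixedNorm T θ₄ p₂ (fun t => dyadicBlock φ (q + k) (f t))) := by
  obtain ⟨C, hC⟩ := exists_eLpNorm_dyadicCommutator_le_of_hasWeakGradient hφ
  refine ⟨C, ?_⟩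
  intro p p₁ p₂ hp hpp θ θ₁ θ₂ θ₃ θ₄ hθ h12 h34 T f g F hf hg hF hfF hF' hf' hg' hgb q
  set μ : Measure ℝ := volume.restrict (Ioo 0 T)
  have hθ₁ : 1 ≤ θ₁ := holder_one_le_left hθ h12
  have hθ₂ : 1 ≤ θ₂ := holder_one_le_left hθ (h12.trans (add_comm _ _))
  have hθ₃ : 1 ≤ θ₃ := holder_one_le_left hθ h34
  have hθ₄ : 1 ≤ θ₄ := holder_one_le_left hθ (h34.trans (add_comm _ _))
  have mF := hF.aemeasurable_eLpNorm (⊤ : ℝ≥0∞)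
  have mg := hg.aemeasurable_eLpNorm p₁
  have mgb := fun j => hg.aemeasurable_eLpNorm_dyadicBlock hφ j p
  have mfb := fun j => hf.aemeasurable_eLpNorm_dyadicBlock hφ j p₂
  -- Finite norms give factors finite at almost every time, as Hölder for [0, ∞]-valued functions
  -- requires here.
  have fF := ae_lt_top_of_eLpNorm_lt_top hθ₁ mF hF'
  have fg := ae_lt_top_of_eLpNorm_lt_top hθ₃ mg hg'
  have fgb := fun j => ae_lt_top_of_eLpNorm_lt_top hθ₂ (mgb j) (hgb j)
  have ffb := fun j => ae_lt_top_of_eLpNorm_lt_top hθ₄ (mfb j) (hf' j)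
  have hpt : ∀ᵐ t ∂μ, eLpNorm (dyadicCommutator φ q (f t) (g t)) p volume ≤ C *
      (∑' n : ℕ, (2 : ℝ≥0∞) ^ (-((q + n : ℤ) : ℝ)) * ∑ k ∈ Finset.Icc (-2 : ℤ) 2,
          eLpNorm (F t) ∞ volume * eLpNorm (dyadicBlock φ (q + n + k) (g t)) p volume
        + ∑ k ∈ Finset.Icc (-2 : ℤ) 2,
          eLpNorm (g t) p₁ volume * eLpNorm (dyadicBlock φ (q + k) (f t)) p₂ volume) := by
    filter_upwards [hfF, fF, fg, hg.prodMk_left] with t h1 h2 h3 h4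
    have h4' : AEStronglyMeasurable (g t) volume := h4
    refine (hC hp hpp h1 h2 ⟨h4', h3⟩ q).trans (le_of_eq ?_)
    rw [← ENNReal.tsum_mul_left, Finset.mul_sum]
    simp only [highTail, ← Finset.mul_sum, mul_left_comm]
  have mterm : ∀ (n : ℕ) (k : ℤ), AEMeasurable (fun t =>
      eLpNorm (F t) ∞ volume * eLpNorm (dyadicBlock φ (q + n + k) (g t)) p volume) μ :=
    fun n k => mF.mul (mgb _)
  have mterm' : ∀ k : ℤ, AEMeasurable (fun t =>
      eLpNorm (g t) p₁ volume * eLpNorm (dyadicBlock φ (q + k) (f t)) p₂ volume) μ :=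
    fun k => mg.mul (mfb _)
  have mS : ∀ n : ℕ, AEMeasurable (fun t => ∑ k ∈ Finset.Icc (-2 : ℤ) 2,
      eLpNorm (F t) ∞ volume * eLpNorm (dyadicBlock φ (q + n + k) (g t)) p volume) μ :=
    fun n => Finset.aemeasurable_fun_sum _ fun k _ => mterm n k
  have mS2 : AEMeasurable (fun t => ∑ k ∈ Finset.Icc (-2 : ℤ) 2,
      eLpNorm (g t) p₁ volume * eLpNorm (dyadicBlock φ (q + k) (f t)) p₂ volume) μ :=
    Finset.aemeasurable_fun_sum _ fun k _ => mterm' k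
  have mW : AEMeasurable (fun t => ∑' n : ℕ, (2 : ℝ≥0∞) ^ (-((q + n : ℤ) : ℝ)) *
      ∑ k ∈ Finset.Icc (-2 : ℤ) 2,
        eLpNorm (F t) ∞ volume * eLpNorm (dyadicBlock φ (q + n + k) (g t)) p volume) μ :=
    AEMeasurable.tsum fun n => (mS n).const_mul _
  refine (eLpNorm_ennreal_mono hpt).trans
    ((eLpNorm_ennreal_const_mul_le (mW.add mS2)).trans (mul_le_mul_right
      ((eLpNorm_ennreal_add_le hθ mW mS2).trans (add_le_add ?_ ?_)) _))
  · rw [← ENNReal.tsum_mul_left]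
    refine (eLpNorm_tsum_le_tsum_eLpNorm hθ fun n => (mS n).const_mul _).trans
      (ENNReal.tsum_le_tsum fun n => ?_)
    rw [mul_left_comm, Finset.mul_sum]
    refine (eLpNorm_ennreal_const_mul_le (mS n)).trans (mul_le_mul_right
      ((eLpNorm_ennreal_sum_le hθ fun k _ => mterm n k).trans (Finset.sum_le_sum fun k _ => ?_)) _)
    exact eLpNorm_ennreal_mul_le h12 mF (mgb _) fF (fgb _)
  · rw [Finset.mul_sum]
    refine (eLpNorm_ennreal_sum_le hθ fun k _ => mterm' k).trans (Finset.sum_le_sum fun k _ => ?_)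
    exact eLpNorm_ennreal_mul_le h34 mg (mfb _) fg (ffb _)

end TimeEstimate

/-! ### Summation over frequencies in ℓ^r. -/

section Summation

theorem le_ellNorm {r : ℝ≥0∞} (hr : 1 ≤ r) (a : ℤ → ℝ≥0∞) (q : ℤ) : a q ≤ ellNorm r a := by
  rw [ellNorm]
  by_cases hrt : r = ∞
  · subst hrt
    have h := ae_le_eLpNormEssSup (f := a) (μ := Measure.count)
    rw [Measure.ae_count_iff] at h
    exact h q
  have hr0 : r ≠ 0 := (zero_lt_one.trans_le hr).ne'
  have hrr : 0 < r.toReal := ENNReal.toReal_pos hr0 hrt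
  rw [eLpNorm_eq_lintegral_rpow_enorm_toReal hr0 hrt, lintegral_count, one_div,
    ENNReal.le_rpow_inv_iff hrr]
  exact ENNReal.le_tsum (f := fun q => ‖a q‖ₑ ^ r.toReal) q

theorem ellNorm_comp_add_right (r : ℝ≥0∞) (a : ℤ → ℝ≥0∞) (m : ℤ) :
    ellNorm r (fun q => a (q + m)) = ellNorm r a := by
  have h : Measure.map (fun q : ℤ => q + m) Measure.count = Measure.count :=
    (measurePreserving_add_right (Measure.count : Measure ℤ) m).map_eq
  rw [ellNorm, ellNorm]
  conv_rhs => rw [← h]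
  rw [eLpNorm_map_measure (Measurable.of_discrete).aestronglyMeasurable
    (Measurable.of_discrete).aemeasurable]
  rfl

theorem ellNorm_mono {r : ℝ≥0∞} {a b : ℤ → ℝ≥0∞} (h : ∀ q, a q ≤ b q) :
    ellNorm r a ≤ ellNorm r b :=
  eLpNorm_ennreal_mono (Filter.Eventually.of_forall h)

theorem ellNorm_const_mul_le (r c : ℝ≥0∞) (a : ℤ → ℝ≥0∞) :
    ellNorm r (fun q => c * a q) ≤ c * ellNorm r a :=
  eLpNorm_ennreal_const_mul_le (Measurable.of_discrete).aemeasurable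

theorem ellNorm_add_le {r : ℝ≥0∞} (hr : 1 ≤ r) (a b : ℤ → ℝ≥0∞) :
    ellNorm r (fun q => a q + b q) ≤ ellNorm r a + ellNorm r b :=
  eLpNorm_ennreal_add_le hr (Measurable.of_discrete).aemeasurable
    (Measurable.of_discrete).aemeasurable

theorem ellNorm_sum_le {r : ℝ≥0∞} (hr : 1 ≤ r) {ι : Type*} (s : Finset ι) (a : ι → ℤ → ℝ≥0∞) :
    ellNorm r (fun q => ∑ i ∈ s, a i q) ≤ ∑ i ∈ s, ellNorm r (a i) :=
  eLpNorm_ennreal_sum_le hr fun _ _ => (Measurable.of_discrete).aemeasurable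

theorem ellNorm_tsum_le {r : ℝ≥0∞} (hr : 1 ≤ r) (a : ℕ → ℤ → ℝ≥0∞) :
    ellNorm r (fun q => ∑' n, a n q) ≤ ∑' n, ellNorm r (a n) :=
  eLpNorm_tsum_le_tsum_eLpNorm hr fun _ => (Measurable.of_discrete).aemeasurable

theorem ellNorm_sum_shift_le {r : ℝ≥0∞} (hr : 1 ≤ r) (s : Finset ℤ) (m : ℤ) (w : ℤ → ℝ≥0∞)
    (a : ℤ → ℝ≥0∞) :
    ellNorm r (fun q => ∑ k ∈ s, w k * a (q + m + k)) ≤ (∑ k ∈ s, w k) * ellNorm r a := by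
  refine (ellNorm_sum_le hr s _).trans ?_
  rw [Finset.sum_mul]
  refine Finset.sum_le_sum fun k _ => ?_
  refine (ellNorm_const_mul_le r (w k) fun q => a (q + m + k)).trans (le_of_eq ?_)
  simp only [add_assoc]
  rw [ellNorm_comp_add_right]

theorem two_rpow_ne_top (x : ℝ) : (2 : ℝ≥0∞) ^ x ≠ ∞ :=
  ENNReal.rpow_ne_top_of_ne_zero two_ne_zero ENNReal.ofNat_ne_top

theorem two_rpow_ne_zero (x : ℝ) : (2 : ℝ≥0∞) ^ x ≠ 0 := by
  rw [Ne, ENNReal.rpow_eq_zero_iff]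
  simp

theorem two_rpow_add (x y : ℝ) : (2 : ℝ≥0∞) ^ (x + y) = (2 : ℝ≥0∞) ^ x * (2 : ℝ≥0∞) ^ y :=
  ENNReal.rpow_add _ _ two_ne_zero ENNReal.ofNat_ne_top

theorem tsum_two_rpow_neg_mul_ne_top {σ : ℝ} (hσ : 0 < σ) :
    ∑' n : ℕ, (2 : ℝ≥0∞) ^ (-((n : ℝ) * σ)) ≠ ∞ := by
  have h : ∀ n : ℕ, (2 : ℝ≥0∞) ^ (-((n : ℝ) * σ)) = ((2 : ℝ≥0∞) ^ (-σ)) ^ n := fun n => by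
    rw [← ENNReal.rpow_natCast, ← ENNReal.rpow_mul]
    congr 1
    ring
  simp only [h, ENNReal.tsum_geometric]
  rw [Ne, ENNReal.inv_eq_top, tsub_eq_zero_iff_le, not_le]
  exact ENNReal.rpow_lt_one_of_one_lt_of_neg ENNReal.one_lt_two (neg_lt_zero.2 hσ)

/-- The exponents satisfy q(s+1) - (q+n) = -n(s+1) + (q+n)s, so each n contributes a shifted copy of
the weighted sequence `b`, damped by 2^{-n(s+1)}. Norms in ℓ^r are shift invariant, and s > -1 makes
the damping summable. -/
theorem exists_ellNorm_le_of_le_tail {s : ℝ} (hs : -1 < s) :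
    ∃ C : ℝ≥0, ∀ {r : ℝ≥0∞}, 1 ≤ r → ∀ {K A B : ℝ≥0∞} {d a b : ℤ → ℝ≥0∞},
      (∀ q : ℤ, d q ≤ K * (A * ∑' n : ℕ, (2 : ℝ≥0∞) ^ (-((q + n : ℤ) : ℝ)) *
        ∑ k ∈ Finset.Icc (-2 : ℤ) 2, b (q + n + k) + B * ∑ k ∈ Finset.Icc (-2 : ℤ) 2, a (q + k))) →
      ellNorm r (fun q => (2 : ℝ≥0∞) ^ ((q : ℝ) * (s + 1)) * d q) ≤ C * (K *
        (A * ellNorm r (fun q => (2 : ℝ≥0∞) ^ ((q : ℝ) * s) * b q)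
          + B * ellNorm r (fun q => (2 : ℝ≥0∞) ^ ((q : ℝ) * (s + 1)) * a q))) := by
  set Q := Finset.Icc (-2 : ℤ) 2
  set G : ℝ≥0∞ := ∑' n : ℕ, (2 : ℝ≥0∞) ^ (-((n : ℝ) * (s + 1))) with hG
  -- `H` and `J` are the costs of realigning the weights after the shifts |k| ≤ 2, for `b` and `a`
  -- respectively.
  set H : ℝ≥0∞ := ∑ k ∈ Q, (2 : ℝ≥0∞) ^ (-((k : ℝ) * s)) with hH
  set J : ℝ≥0∞ := ∑ k ∈ Q, (2 : ℝ≥0∞) ^ (-((k : ℝ) * (s + 1))) with hJ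
  have hGt : G ≠ ∞ := tsum_two_rpow_neg_mul_ne_top (by linarith)
  have hHt : H ≠ ∞ := ENNReal.sum_ne_top.2 fun k _ => two_rpow_ne_top _
  have hJt : J ≠ ∞ := ENNReal.sum_ne_top.2 fun k _ => two_rpow_ne_top _
  refine ⟨(G * H + J).toNNReal, ?_⟩
  intro r hr K A B d a b hd
  rw [ENNReal.coe_toNNReal (ENNReal.add_ne_top.2 ⟨ENNReal.mul_ne_top hGt hHt, hJt⟩)]
  set b' : ℤ → ℝ≥0∞ := fun q => (2 : ℝ≥0∞) ^ ((q : ℝ) * s) * b q with hb'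
  set a' : ℤ → ℝ≥0∞ := fun q => (2 : ℝ≥0∞) ^ ((q : ℝ) * (s + 1)) * a q with ha'
  have hpt : ∀ q : ℤ, (2 : ℝ≥0∞) ^ ((q : ℝ) * (s + 1)) * d q ≤
      K * (A * ∑' n : ℕ, (2 : ℝ≥0∞) ^ (-((n : ℝ) * (s + 1))) *
          ∑ k ∈ Q, (2 : ℝ≥0∞) ^ (-((k : ℝ) * s)) * b' (q + n + k)
        + B * ∑ k ∈ Q, (2 : ℝ≥0∞) ^ (-((k : ℝ) * (s + 1))) * a' (q + 0 + k)) := fun q => by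
    refine (mul_le_mul_right (hd q) _).trans (le_of_eq ?_)
    have e1 : (2 : ℝ≥0∞) ^ ((q : ℝ) * (s + 1)) * ∑' n : ℕ, (2 : ℝ≥0∞) ^ (-((q + n : ℤ) : ℝ)) *
        ∑ k ∈ Q, b (q + n + k) = ∑' n : ℕ, (2 : ℝ≥0∞) ^ (-((n : ℝ) * (s + 1))) *
          ∑ k ∈ Q, (2 : ℝ≥0∞) ^ (-((k : ℝ) * s)) * b' (q + n + k) := by
      rw [← ENNReal.tsum_mul_left]
      refine tsum_congr fun n => ?_
      simp only [Finset.mul_sum]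
      refine Finset.sum_congr rfl fun k _ => ?_
      simp only [hb', ← mul_assoc, ← two_rpow_add]
      congr 2
      push_cast
      ring
    have e2 : (2 : ℝ≥0∞) ^ ((q : ℝ) * (s + 1)) * ∑ k ∈ Q, a (q + k)
        = ∑ k ∈ Q, (2 : ℝ≥0∞) ^ (-((k : ℝ) * (s + 1))) * a' (q + 0 + k) := by
      rw [Finset.mul_sum]
      refine Finset.sum_congr rfl fun k _ => ?_
      simp only [ha', ← mul_assoc, ← two_rpow_add, add_zero]
      congr 2
      push_cast
      ring
    rw [← e1, ← e2]
    ring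
  refine (ellNorm_mono hpt).trans ((ellNorm_const_mul_le r K _).trans ?_)
  rw [mul_left_comm]
  refine mul_le_mul_right ((ellNorm_add_le hr _ _).trans ?_) _
  have h1 : ellNorm r (fun q => A * ∑' n : ℕ, (2 : ℝ≥0∞) ^ (-((n : ℝ) * (s + 1))) *
      ∑ k ∈ Q, (2 : ℝ≥0∞) ^ (-((k : ℝ) * s)) * b' (q + n + k)) ≤ A * (G * H * ellNorm r b') := by
    refine (ellNorm_const_mul_le r A _).trans (mul_le_mul_right ?_ _)
    refine (ellNorm_tsum_le hr _).trans ?_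
    rw [hG, mul_assoc, ← ENNReal.tsum_mul_right]
    refine ENNReal.tsum_le_tsum fun n => ?_
    exact (ellNorm_const_mul_le r _ _).trans
      (mul_le_mul_right (ellNorm_sum_shift_le hr Q n _ b') _)
  have h2 : ellNorm r (fun q => B * ∑ k ∈ Q, (2 : ℝ≥0∞) ^ (-((k : ℝ) * (s + 1))) *
      a' (q + 0 + k)) ≤ B * (J * ellNorm r a') :=
    (ellNorm_const_mul_le r B _).trans (mul_le_mul_right (ellNorm_sum_shift_le hr Q 0 _ a') _)
  calc _ ≤ A * (G * H * ellNorm r b') + B * (J * ellNorm r a') := add_le_add h1 h2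
    -- Adding the two cross terms lets the common constant G H + J factor out.
    _ ≤ (A * (G * H * ellNorm r b') + B * (J * ellNorm r a'))
        + (B * (G * H * ellNorm r a') + A * (J * ellNorm r b')) := le_self_add
    _ = _ := by ring

/-- The sequence c_q is the weighted sequence divided by its bound C M; if M = 0 everything vanishes
and c = 0 serves. -/
theorem exists_sequence_of_ellNorm_le {r : ℝ≥0∞} (hr : 1 ≤ r) {C : ℝ≥0} (hC : 0 < C) {M : ℝ≥0∞}
    (hM : M < ∞) {σ : ℝ} {d : ℤ → ℝ≥0∞}
    (h : ellNorm r (fun q => (2 : ℝ≥0∞) ^ ((q : ℝ) * σ) * d q) ≤ C * M) :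
    ∃ c : ℤ → ℝ≥0, ellNorm r (fun q => (c q : ℝ≥0∞)) ≤ 1 ∧
      ∀ q : ℤ, d q ≤ C * c q * (2 : ℝ≥0∞) ^ (-((q : ℝ) * σ)) * M := by
  set e : ℤ → ℝ≥0∞ := fun q => (2 : ℝ≥0∞) ^ ((q : ℝ) * σ) * d q with he
  have hde : ∀ q, d q = (2 : ℝ≥0∞) ^ (-((q : ℝ) * σ)) * e q := fun q => by
    rw [he, ← mul_assoc, ← two_rpow_add, neg_add_cancel, ENNReal.rpow_zero, one_mul]
  have hCM : (C : ℝ≥0∞) * M ≠ ∞ := ENNReal.mul_ne_top ENNReal.coe_ne_top hM.ne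
  have hle : ∀ q, e q ≤ C * M := fun q => (le_ellNorm hr e q).trans h
  rcases eq_or_ne M 0 with rfl | hM0
  · refine ⟨0, by simp [ellNorm], fun q => ?_⟩
    have := hle q
    rw [mul_zero, nonpos_iff_eq_zero] at this
    rw [hde, this]
    simp
  have hCM0 : (C : ℝ≥0∞) * M ≠ 0 := mul_ne_zero (ENNReal.coe_ne_zero.2 hC.ne') hM0
  have hc : ∀ q, ((((C : ℝ≥0∞) * M)⁻¹ * e q).toNNReal : ℝ≥0∞) = ((C : ℝ≥0∞) * M)⁻¹ * e q :=
    fun q => ENNReal.coe_toNNReal (ENNReal.mul_ne_top (ENNReal.inv_ne_top.2 hCM0)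
      ((hle q).trans_lt hCM.lt_top).ne)
  refine ⟨fun q => (((C : ℝ≥0∞) * M)⁻¹ * e q).toNNReal, ?_, fun q => ?_⟩
  · simp only [hc]
    refine (ellNorm_const_mul_le r _ e).trans ((mul_le_mul_right h _).trans (le_of_eq ?_))
    exact ENNReal.inv_mul_cancel hCM0 hCM
  · rw [hc, hde]
    refine le_of_eq ?_
    calc (2 : ℝ≥0∞) ^ (-((q : ℝ) * σ)) * e q
        = ((C * M) * (C * M)⁻¹) * ((2 : ℝ≥0∞) ^ (-((q : ℝ) * σ)) * e q) := by
          rw [ENNReal.mul_inv_cancel hCM0 hCM, one_mul]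
      _ = _ := by ring

end Summation

/-! ### The estimate in Chemin-Lerner spaces and its static case. -/

section Main

variable {N : ℕ} {φ : 𝓢(EuclideanSpace ℝ (Fin N), ℝ)}

theorem mixedNorm_lt_top_of_cheminLernerNorm_lt_top {T : ℝ} {θ p r : ℝ≥0∞} (hr : 1 ≤ r) {s : ℝ}
    {u : ℝ → EuclideanSpace ℝ (Fin N) → ℂ} (h : cheminLernerNorm φ T θ s p r u < ∞) (j : ℤ) :
    mixedNorm T θ p (fun t => dyadicBlock φ j (u t)) < ∞ := by
  have h1 := (le_ellNorm hr _ j).trans_lt h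
  exact ENNReal.lt_top_of_mul_ne_top_right h1.ne (two_rpow_ne_zero _)

/-- The commutator estimate in Chemin-Lerner spaces. -/
theorem exists_commutator_estimate_cheminLerner (hφ : IsDyadicGenerator φ) {s : ℝ} (hs : -1 < s)
    {p r : ℝ≥0∞} (hp : 1 ≤ p) (hr : 1 ≤ r) :
    ∃ C : ℝ≥0, 0 < C ∧ ∀ (p₁ p₂ : ℝ≥0∞), p⁻¹ = p₁⁻¹ + p₂⁻¹ →
      ∀ (θ θ₁ θ₂ θ₃ θ₄ : ℝ≥0∞), 1 ≤ θ → θ⁻¹ = θ₁⁻¹ + θ₂⁻¹ → θ⁻¹ = θ₃⁻¹ + θ₄⁻¹ →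
      ∀ (T : ℝ) (f g : ℝ → EuclideanSpace ℝ (Fin N) → ℂ)
        (gradf : ℝ → EuclideanSpace ℝ (Fin N) → EuclideanSpace ℂ (Fin N)),
      SpaceTimeMeasurable T f → SpaceTimeMeasurable T g → SpaceTimeMeasurable T gradf →
      (∀ᵐ t ∂(volume.restrict (Ioo 0 T)), HasWeakGradient (f t) (gradf t)) →
      mixedNorm T θ₁ ∞ gradf < ∞ → cheminLernerNorm φ T θ₄ (s + 1) p₂ r f < ∞ →
      mixedNorm T θ₃ p₁ g < ∞ → cheminLernerNorm φ T θ₂ s p r g < ∞ →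
      ∃ c : ℤ → ℝ≥0, ellNorm r (fun q => (c q : ℝ≥0∞)) ≤ 1 ∧
        ∀ q : ℤ, mixedNorm T θ p (fun t => dyadicCommutator φ q (f t) (g t)) ≤
          C * c q * (2 : ℝ≥0∞) ^ (-((q : ℝ) * (s + 1))) *
            (mixedNorm T θ₁ ∞ gradf * cheminLernerNorm φ T θ₂ s p r g +
              mixedNorm T θ₃ p₁ g * cheminLernerNorm φ T θ₄ (s + 1) p₂ r f) := by
  obtain ⟨C₁, hC₁⟩ := exists_mixedNorm_dyadicCommutator_le hφ
  obtain ⟨C₂, hC₂⟩ := exists_ellNorm_le_of_le_tail hs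
  -- The added 1 only makes the constant positive, as the normalization of c_q requires.
  refine ⟨C₂ * C₁ + 1, by positivity, ?_⟩
  intro p₁ p₂ hpp θ θ₁ θ₂ θ₃ θ₄ hθ h12 h34 T f g gradf hf hg hF hfF hF' hf' hg' hgb
  have key := hC₁ hp hpp hθ h12 h34 hf hg hF hfF hF'
    (mixedNorm_lt_top_of_cheminLernerNorm_lt_top hr hf') hg'
    (mixedNorm_lt_top_of_cheminLernerNorm_lt_top hr hgb)
  have hsum := hC₂ hr (K := C₁) (A := mixedNorm T θ₁ ∞ gradf) (B := mixedNorm T θ₃ p₁ g)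
    (d := fun q => mixedNorm T θ p (fun t => dyadicCommutator φ q (f t) (g t)))
    (a := fun j => mixedNorm T θ₄ p₂ (fun t => dyadicBlock φ j (f t)))
    (b := fun j => mixedNorm T θ₂ p (fun t => dyadicBlock φ j (g t))) key
  refine exists_sequence_of_ellNorm_le hr (by positivity)
    (ENNReal.add_lt_top.2 ⟨ENNReal.mul_lt_top hF' hgb, ENNReal.mul_lt_top hg' hf'⟩)
    (hsum.trans ?_)
  rw [← mul_assoc, ← ENNReal.coe_mul]
  exact mul_le_mul_left (ENNReal.coe_le_coe.2 le_self_add) _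

theorem mixedNorm_const {V : Type*} [NormedAddCommGroup V] (p : ℝ≥0∞)
    (u : EuclideanSpace ℝ (Fin N) → V) :
    mixedNorm 1 ∞ p (fun _ => u) = eLpNorm u p volume := by
  rw [mixedNorm, eLpNorm_const _ ENNReal.top_ne_zero]
  · simp
  · simp [Measure.restrict_eq_zero]

theorem cheminLernerNorm_const (s : ℝ) (p r : ℝ≥0∞) (u : EuclideanSpace ℝ (Fin N) → ℂ) :
    cheminLernerNorm φ 1 ∞ s p r (fun _ => u) = homBesovNorm φ s p r u := by
  simp only [cheminLernerNorm, homBesovNorm, mixedNorm_const]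

theorem spaceTimeMeasurable_const {V : Type*} [NormedAddCommGroup V]
    {u : EuclideanSpace ℝ (Fin N) → V} (hu : AEStronglyMeasurable u volume) (T : ℝ) :
    SpaceTimeMeasurable T (fun _ => u) :=
  hu.comp_snd

end Main

end

theorem proposition5p1 (N : ℕ) (hN : 1 ≤ N) (φ : 𝓢(EuclideanSpace ℝ (Fin N), ℝ))
    (hφ : IsDyadicGenerator φ) (s : ℝ) (hs : -1 < s) (p r : ℝ≥0∞) (hp : 1 ≤ p) (hr : 1 ≤ r) :
    ∃ C : ℝ≥0, 0 < C ∧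
      (∀ (p₁ p₂ : ℝ≥0∞), p⁻¹ = p₁⁻¹ + p₂⁻¹ →
        ∀ (f g : EuclideanSpace ℝ (Fin N) → ℂ)
          (gradf : EuclideanSpace ℝ (Fin N) → EuclideanSpace ℂ (Fin N)),
        HasWeakGradient f gradf → MemLp gradf ∞ volume → homBesovNorm φ (s + 1) p₂ r f < ∞ →
        MemLp g p₁ volume → homBesovNorm φ s p r g < ∞ →
        ∃ c : ℤ → ℝ≥0, ellNorm r (fun q => (c q : ℝ≥0∞)) ≤ 1 ∧
          ∀ q : ℤ, eLpNorm (dyadicCommutator φ q f g) p volume ≤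
            C * c q * (2 : ℝ≥0∞) ^ (-((q : ℝ) * (s + 1))) *
              (eLpNorm gradf ∞ volume * homBesovNorm φ s p r g +
                eLpNorm g p₁ volume * homBesovNorm φ (s + 1) p₂ r f)) ∧
      (∀ (p₁ p₂ : ℝ≥0∞), p⁻¹ = p₁⁻¹ + p₂⁻¹ →
        ∀ (θ θ₁ θ₂ θ₃ θ₄ : ℝ≥0∞), 1 ≤ θ → θ⁻¹ = θ₁⁻¹ + θ₂⁻¹ → θ⁻¹ = θ₃⁻¹ + θ₄⁻¹ →
        ∀ (T : ℝ), 0 < T →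
        ∀ (f g : ℝ → EuclideanSpace ℝ (Fin N) → ℂ)
          (gradf : ℝ → EuclideanSpace ℝ (Fin N) → EuclideanSpace ℂ (Fin N)),
        SpaceTimeMeasurable T f → SpaceTimeMeasurable T g → SpaceTimeMeasurable T gradf →
        (∀ᵐ t ∂(volume.restrict (Ioo 0 T)), HasWeakGradient (f t) (gradf t)) →
        mixedNorm T θ₁ ∞ gradf < ∞ → cheminLernerNorm φ T θ₄ (s + 1) p₂ r f < ∞ →
        mixedNorm T θ₃ p₁ g < ∞ → cheminLernerNorm φ T θ₂ s p r g < ∞ →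
        ∃ c : ℤ → ℝ≥0, ellNorm r (fun q => (c q : ℝ≥0∞)) ≤ 1 ∧
          ∀ q : ℤ, mixedNorm T θ p (fun t => dyadicCommutator φ q (f t) (g t)) ≤
            C * c q * (2 : ℝ≥0∞) ^ (-((q : ℝ) * (s + 1))) *
              (mixedNorm T θ₁ ∞ gradf * cheminLernerNorm φ T θ₂ s p r g +
                mixedNorm T θ₃ p₁ g * cheminLernerNorm φ T θ₄ (s + 1) p₂ r f)) := by
  obtain ⟨C, hC0, hC⟩ := exists_commutator_estimate_cheminLerner hφ hs hp hr
  refine ⟨C, hC0, ?_, fun p₁ p₂ hpp θ θ₁ θ₂ θ₃ θ₄ hθ h12 h34 T _ =>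
    hC p₁ p₂ hpp θ θ₁ θ₂ θ₃ θ₄ hθ h12 h34 T⟩
  intro p₁ p₂ hpp f g gradf hf hF hfb hg hgb
  -- For time-independent functions on (0, 1) with all time exponents infinite, the space-time norms
  -- reduce to the static ones.
  have h := hC p₁ p₂ hpp ∞ ∞ ∞ ∞ ∞ le_top (by simp) (by simp) 1 (fun _ => f) (fun _ => g)
    (fun _ => gradf) (spaceTimeMeasurable_const hf.locallyIntegrable.aestronglyMeasurable 1)
    (spaceTimeMeasurable_const hg.1 1) (spaceTimeMeasurable_const hF.1 1)
    (Filter.Eventually.of_forall fun _ => hf)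
  simp only [mixedNorm_const, cheminLernerNorm_const] at h
  exact h hF.2 hfb hg.2 hgb
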